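/- Let $r\ge 1$ and let $\gamma_1,\dots,\gamma_r\in\mathbb{C}$ with $\Re\gamma_j>0$ for all $j$. For $c\in\mathbb{R}$ and $t=(t_1,\dots,t_r)\in\mathbb{C}^r$ put $$\widetilde{\mathfrak H}_r(t;\gamma;c)=\prod_{j=1}^r K_c\Bigl(\gamma_j\sum_{k=j}^r t_k\Bigr),\qquad K_c(y)=\frac{1}{e^{y}-1}-\frac{c}{e^{cy}-1},$$ where the removable singularity at $y=0$ is filled in by $K_c(0)=(c-1)/2$. For $\varepsilon>0$ let $\mathcal C=\mathcal C_\varepsilon$ be the Hankel contour: it comes from $+\infty$ to $\varepsilon$ along the top side of the positive real axis (where $\arg t=0$), runs once counterclockwise around the circle $|t|=\varepsilon$, and returns to $+\infty$ along the bottom side (where $\arg t=2\pi$); $t^{s-1}=e^{(s-1)\log t}$ is taken with this argument. The factor $1/((e^{2\pi i s}-1)\Gamma(s))$ is given its limit at its removable singularities $s=0,-1,-2,\dots$. Let $U$ be the set of $(s_j)\in\mathbb{C}^r$ with no $s_j$ in $\{1,2,3,\dots\}$. There is $\varepsilon_0>0$, depending only on $r$ and the $\gamma_j$, such that the following holds for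 every $0<\varepsilon<\varepsilon_0$. (i) There are $\delta>0$ and $A>0$ such that, for all $c\in\mathbb{R}$ with $0<|c-1|<\delta$ and all $t\in\mathcal C^r$, $$\bigl|(c-1)^{-r}\,\widetilde{\mathfrak H}_r(t;\gamma;c)\bigr|\le F(t):=A\prod_{k=1}^r\exp\Bigl(-\Re\bigl(t_k\tfrac{\gamma_1+\cdots+\gamma_k}{2}\bigr)\Bigr),$$ and $\int_{\mathcal C^r}F(t)\prod_{k}|t_k^{s_k-1}\,dt_k|<\infty$ for all $(s_j)\in\mathbb{C}^r$. In particular $\int_{\mathcal C^r}\widetilde{\mathfrak H}_r(t;\gamma;c)\prod_k t_k^{s_k-1}dt_k$ converges absolutely for these $c$ and all $(s_j)\in\mathbb{C}^r$. (ii) For every $(s_j)\in U$ the limit over $c\in\mathbb{R}\setminus\{1\}$ $$\zeta^{\rm des}_r((s_j);(\gamma_j)):=\lim_{c\to1}\frac{(-1)^r}{(c-1)^r}\prod_{k=1}^r\frac{1}{(e^{2\pi i s_k}-1)\Gamma(s_k)}\int_{\mathcal C^r}\widetilde{\mathfrak H}_r(t;\gamma;c)\prod_{k=1}^r t_k^{s_k-1}dt_k$$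 exists, and $$\zeta^{\rm des}_r((s_j);(\gamma_j))=\prod_{k=1}^r\frac{1}{(e^{2\pi i s_k}-1)\Gamma(s_k)}\int_{\mathcal C^r}\lim_{c\to1}\frac{(-1)^r}{(c-1)^r}\widetilde{\mathfrak H}_r(t;\gamma;c)\prod_{k=1}^r t_k^{s_k-1}dt_k$$ $$=\prod_{k=1}^r\frac{1}{(e^{2\pi i s_k}-1)\Gamma(s_k)}\int_{\mathcal C^r}\prod_{j=1}^r\lim_{c\to1}\frac{-1}{c-1}\,K_c\Bigl(\gamma_j\sum_{k=j}^r t_k\Bigr)\prod_{k=1}^r t_k^{s_k-1}dt_k,$$ where the limits under the integral signs exist at every point of $\mathcal C^r$ and the integrals converge absolutely, for all $(s_j)\in\mathbb{C}^r$. (iii) The function $(s_j)\mapsto\zeta^{\rm des}_r((s_j);(\gamma_j))$ on $U$ extends to an entire function on $\mathbb{C}^r$, which is the same for all $0<\varepsilon<\varepsilon_0$. -/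

import Mathlib

open Filter Topology MeasureTheory

noncomputable section

namespace DesZeta

/-- The function `1/(e^y - 1) - c/(e^{cy} - 1)` of `y`, with its removable singularity
at `y = 0` filled in by its limit `(c - 1)/2`. -/
def kernel (c : ℝ) (y : ℂ) : ℂ :=
  if y = 0 then ((c : ℂ) - 1) / 2
  else 1 / (Complex.exp y - 1) - (c : ℂ) / (Complex.exp ((c : ℂ) * y) - 1)

/-- The argument `γ_j (t_j + t_{j+1} + ⋯ + t_r)` of the `j`-th factor. -/
def tailArg {r : ℕ} (γ t : Fin r → ℂ) (j : Fin r) : ℂ :=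
  γ j * ∑ k ∈ Finset.Ici j, t k

/-- The generating function `H̃_r((t_j); (γ_j); c)`. -/
def tildeH {r : ℕ} (γ : Fin r → ℂ) (c : ℝ) (t : Fin r → ℂ) : ℂ :=
  ∏ j, kernel c (tailArg γ t j)

/-- Modulus of the Hankel contour: from `+∞` down to `ε` for `u ≤ 0`, equal to `ε` for
`0 ≤ u ≤ 2π`, from `ε` back to `+∞` for `u ≥ 2π`. -/
def hankelRadius (ε u : ℝ) : ℝ :=
  ε + max (-u) 0 + max (u - 2 * Real.pi) 0

/-- Continuously chosen argument along the Hankel contour: `0` on the top side of the positive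
real axis, `u` on the circle, `2π` on the bottom side. -/
def hankelAngle (u : ℝ) : ℝ :=
  max 0 (min u (2 * Real.pi))

/-- Parametrization by `u ∈ ℝ` of the Hankel contour with circle of radius `ε`. -/
def hankelPoint (ε u : ℝ) : ℂ :=
  (hankelRadius ε u : ℂ) * Complex.exp (Complex.I * (hankelAngle u : ℂ))

/-- `dt/du` for `t = hankelPoint ε u`. -/
def hankelVelocity (ε u : ℝ) : ℂ :=
  if u < 0 then -1
  else if u ≤ 2 * Real.pi then Complex.I * (ε : ℂ) * Complex.exp (Complex.I * (u : ℂ))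
  else 1

/-- The power `t^a` on the Hankel contour, for the branch of `log t` that is real on the top
side and has imaginary part `2π` on the bottom side. -/
def hankelPow (ε u : ℝ) (a : ℂ) : ℂ :=
  Complex.exp (a * ((Real.log (hankelRadius ε u) : ℂ) + Complex.I * (hankelAngle u : ℂ)))

/-- The point `(t_1, …, t_r)` of `𝒞^r` with parameter `(u_1, …, u_r)`. -/
def hankelPoints {r : ℕ} (ε : ℝ) (u : Fin r → ℝ) : Fin r → ℂ :=
  fun k => hankelPoint ε (u k)

/-- The density of `∏ₖ t_k^{s_k - 1} dt_k` with respect to `du_1 ⋯ du_r`. -/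
def hankelWeight {r : ℕ} (ε : ℝ) (s : Fin r → ℂ) (u : Fin r → ℝ) : ℂ :=
  ∏ k, (hankelPow ε (u k) (s k - 1) * hankelVelocity ε (u k))

/-- The integral of `f(t) ∏ₖ t_k^{s_k - 1} dt_k` over `𝒞^r` converges absolutely. -/
def HankelIntegrable {r : ℕ} (ε : ℝ) (s : Fin r → ℂ) (f : (Fin r → ℂ) → ℂ) : Prop :=
  Integrable (fun u : Fin r → ℝ => f (hankelPoints ε u) * hankelWeight ε s u)

/-- The integral of `f(t) ∏ₖ t_k^{s_k - 1} dt_k` over `𝒞^r`. -/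
def hankelIntegral {r : ℕ} (ε : ℝ) (s : Fin r → ℂ) (f : (Fin r → ℂ) → ℂ) : ℂ :=
  ∫ u : Fin r → ℝ, f (hankelPoints ε u) * hankelWeight ε s u

open Classical in
/-- The factor `1/((e^{2πis} - 1) Γ(s))`. At `s = 0, -1, -2, …` its singularity is removable
and it is given its limit there; it has poles at `s = 1, 2, 3, …`. -/
def hankelFactor (s : ℂ) : ℂ :=
  if ∃ n : ℕ, s = -(n : ℂ) then
    limUnder (𝓝[≠] s) (fun z : ℂ =>
      1 / ((Complex.exp (2 * Real.pi * Complex.I * z) - 1) * Complex.Gamma z))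
  else 1 / ((Complex.exp (2 * Real.pi * Complex.I * s) - 1) * Complex.Gamma s)

/-- The points of `ℂ^r` with no coordinate in `{1, 2, 3, …}`: those at which the factors
`1/((e^{2πi s_k} - 1) Γ(s_k))` are finite. -/
def regularPoints (r : ℕ) : Set (Fin r → ℂ) :=
  {s | ∀ k, ∀ n : ℕ, s k ≠ (n : ℂ) + 1}

/-- The expression whose limit as `c → 1` is the desingularized multiple zeta-function. -/
def preDesZeta {r : ℕ} (ε : ℝ) (γ : Fin r → ℂ) (c : ℝ) (s : Fin r → ℂ) : ℂ :=
  (-1) ^ r / ((c : ℂ) - 1) ^ r * (∏ k, hankelFactor (s k)) * hankelIntegral ε s (tildeH γ c)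

/-- The desingularized multiple zeta-function, computed with circles of radius `ε`. -/
def desZeta {r : ℕ} (ε : ℝ) (γ : Fin r → ℂ) (s : Fin r → ℂ) : ℂ :=
  limUnder (𝓝[≠] (1 : ℝ)) (fun c : ℝ => preDesZeta ε γ c s)

/-- The exponential majorant `∏ₖ exp(-Re(t_k (γ_1 + ⋯ + γ_k)/2))`. -/
def majorant {r : ℕ} (γ t : Fin r → ℂ) : ℝ :=
  ∏ k, Real.exp (-(t k * ((∑ j ∈ Finset.Iic k, γ j) / 2)).re)

end DesZeta

end

/-
Put `T z = z / (e ^ z - 1)`. Then `-K_c(y) / (c - 1)` is the difference quotient of `T` between `y`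
and `c y`, so it tends to the derivative of `T` at `y`, and by the mean value inequality and
Cauchy's estimate it is `O(exp (-Re y / 2))`, uniformly for `|c - 1| < 1 / 3`, on a wedge around the
positive axis containing no pole of `T`. Multiplying over `j` gives exactly the majorant, and
dominated convergence takes the limit under the integral.

For the continuation, the factor `1 / ((e ^ (2πis) - 1) Γ(s))` is holomorphic off the positive
integers, while for `Re s > 0` the normalized Hankel integral collapses to `1 / Γ(s)` times the
Mellin integral over the half-line, which makes no reference to `ε`. By Fubini one may pass from one
expression to the other in each variable separately, so the resulting local expressions, all
holomorphic, glue to one entire function.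
-/

namespace DesZeta

section ParametricIntegrals

variable {E F α : Type*} [NormedAddCommGroup E] [NormedSpace ℂ E] [NormedAddCommGroup F]
  [NormedSpace ℂ F] [MeasurableSpace α] {μ : Measure α} {H : E → α → F} {x₀ : E}

theorem aestronglyMeasurable_fderiv_apply_of_eventually
    (hmeas : ∀ᶠ x in 𝓝 x₀, AEStronglyMeasurable (H x) μ)
    (hdiff : ∀ᵐ a ∂μ, DifferentiableAt ℂ (H · a) x₀) (v : E) :
    AEStronglyMeasurable (fun a => fderiv ℂ (H · a) x₀ v) μ := by
  have hc : Tendsto (fun n : ℕ => ‖(n : ℂ)‖) atTop atTop := by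
    simpa using tendsto_natCast_atTop_atTop (R := ℝ)
  have hx : Tendsto (fun n : ℕ => x₀ + (n : ℂ)⁻¹ • v) atTop (𝓝 x₀) := by
    simpa using ((tendsto_inv₀_cobounded.comp
      (tendsto_norm_atTop_iff_cobounded.1 hc)).smul_const v).const_add x₀
  obtain ⟨N, hN⟩ := eventually_atTop.1 (hx.eventually hmeas)
  refine aestronglyMeasurable_of_tendsto_ae atTop
    (f := fun (n : ℕ) a => ((n + N : ℕ) : ℂ) • (H (x₀ + ((n + N : ℕ) : ℂ)⁻¹ • v) a - H x₀ a))
    (fun n => ((hN _ (Nat.le_add_left N n)).sub hmeas.self_of_nhds).fun_const_smul _) ?_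
  filter_upwards [hdiff] with a ha
  exact (ha.hasFDerivAt.lim v hc).comp (tendsto_add_atTop_nat N)

theorem aestronglyMeasurable_fderiv_of_eventually [FiniteDimensional ℂ E]
    (hmeas : ∀ᶠ x in 𝓝 x₀, AEStronglyMeasurable (H x) μ)
    (hdiff : ∀ᵐ a ∂μ, DifferentiableAt ℂ (H · a) x₀) :
    AEStronglyMeasurable (fun a => fderiv ℂ (H · a) x₀) μ := by
  let b := Module.finBasis ℂ E
  have hsum (L : E →L[ℂ] F) :
      L = ∑ i, (b.coord i).toContinuousLinearMap.smulRight (L (b i)) := by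
    ext v
    conv_lhs => rw [← b.sum_repr v]
    simp [-Module.Basis.sum_repr]
  rw [show (fun a => fderiv ℂ (H · a) x₀) = _ from funext fun a => hsum _]
  refine Finset.aestronglyMeasurable_fun_sum _ fun i _ => ?_
  exact (ContinuousLinearMap.smulRightL ℂ E F
    (b.coord i).toContinuousLinearMap).continuous.comp_aestronglyMeasurable
    (aestronglyMeasurable_fderiv_apply_of_eventually hmeas hdiff (b i))

theorem differentiableAt_integral_of_dominated [FiniteDimensional ℂ E] {B : α → ℝ}
    {s : Set E} (hs : s ∈ 𝓝 x₀) (hmeas : ∀ x ∈ s, AEStronglyMeasurable (H x) μ)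
    (hdiff : ∀ᵐ a ∂μ, ∀ x ∈ s, DifferentiableAt ℂ (H · a) x)
    (hB : Integrable B μ) (hbound : ∀ᵐ a ∂μ, ∀ x ∈ s, ‖H x a‖ ≤ B a) :
    DifferentiableAt ℂ (fun x => ∫ a, H x a ∂μ) x₀ := by
  obtain ⟨R, hR, hRs⟩ := Metric.mem_nhds_iff.1 hs
  have hsub {x} (hx : x ∈ Metric.ball x₀ (R / 2)) : Metric.ball x (R / 2) ⊆ s :=
    (Metric.ball_subset_ball' (by linarith [Metric.mem_ball.1 hx])).trans hRs
  have hx₀ : x₀ ∈ s := mem_of_mem_nhds hs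
  refine (hasFDerivAt_integral_of_dominated_of_fderiv_le (𝕜 := ℂ)
    (bound := fun a => 2 * B a / (R / 2)) (F' := fun x a => fderiv ℂ (H · a) x)
    (Metric.ball_mem_nhds x₀ (half_pos hR)) (eventually_of_mem hs hmeas)
    (hB.mono' (hmeas x₀ hx₀) (hbound.mono fun a ha => ha x₀ hx₀))
    (aestronglyMeasurable_fderiv_of_eventually (eventually_of_mem hs hmeas)
      (hdiff.mono fun a ha => ha x₀ hx₀)) ?_ ((hB.const_mul 2).div_const _) ?_).differentiableAt
  · filter_upwards [hdiff, hbound] with a hda hba x hx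
    refine Complex.norm_fderiv_le_div_of_mapsTo_ball
      (fun y hy => (hda y (hsub hx hy)).differentiableWithinAt) (fun y hy => ?_) (half_pos hR)
    have hxx : x ∈ s := hsub hx (Metric.mem_ball_self (half_pos hR))
    rw [mem_closedBall_iff_norm]
    linarith [norm_sub_le (H y a) (H x a), hba y (hsub hx hy), hba x hxx]
  · filter_upwards [hdiff] with a hda x hx
    exact (hda x (hsub hx (Metric.mem_ball_self (half_pos hR)))).hasFDerivAt

end ParametricIntegrals

section IteratedIntegrals

variable {ι E : Type*} [Fintype ι] [DecidableEq ι] [NormedAddCommGroup E] [NormedSpace ℝ E]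
  {F G : (ι → ℝ) → E}

theorem integral_pi_eq_integral_integral (hF : Integrable F) (k : ι) :
    ∫ u, F u = ∫ y : {i // i ≠ k} → ℝ, ∫ x : ℝ, F fun i => if h : i = k then x else y ⟨i, h⟩ := by
  have he := @volume_preserving_piEquivPiSubtypeProd ι _ (fun _ => ℝ) _
    (fun _ => inferInstance) (· = k) _
  set e := MeasurableEquiv.piEquivPiSubtypeProd (fun _ : ι => ℝ) (· = k)
  rw [← (he.symm e).integral_comp', Measure.volume_eq_prod, integral_prod_symm]
  · refine integral_congr_ae (ae_of_all _ fun y => ?_)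
    convert (((volume_preserving_piUnique fun _ : {i // i = k} => ℝ).symm _).integral_comp'
      fun x => F (e.symm (x, y))).symm
    rfl
  · exact ((he.symm e).integrable_comp_emb e.symm.measurableEmbedding).2 hF

theorem integral_eq_of_forall_integral_update_eq (hF : Integrable F) (hG : Integrable G) (k : ι)
    (h : ∀ u, ∫ x, F (Function.update u k x) = ∫ x, G (Function.update u k x)) :
    ∫ u, F u = ∫ u, G u := by
  rw [integral_pi_eq_integral_integral hF k, integral_pi_eq_integral_integral hG k]
  congr! 2 with y
  obtain ⟨u₀, hu₀⟩ : ∃ u₀ : ι → ℝ, ∀ x : ℝ,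
      (fun i => if h : i = k then x else y ⟨i, h⟩) = Function.update u₀ k x :=
    ⟨fun i => if h : i = k then 0 else y ⟨i, h⟩, fun x => by
      ext i
      by_cases hi : i = k <;> simp [hi]⟩
  simpa only [hu₀] using h u₀

end IteratedIntegrals

section HankelFactor

open Complex

theorem exp_two_pi_mul_I_mul_sub_one (z : ℂ) :
    exp (2 * Real.pi * I * z) - 1 = 2 * I * exp (Real.pi * I * z) * sin (Real.pi * z) := by
  have h (w : ℂ) : exp (2 * w * I) - 1 = 2 * I * exp (w * I) * sin w := by
    rw [sin, show 2 * w * I = w * I + w * I by ring, exp_add, neg_mul, exp_neg]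
    field_simp
    linear_combination (exp (w * I) ^ 2 - 1) * I_sq
  convert h (Real.pi * z) using 3 <;> ring_nf

theorem one_div_exp_sub_one_mul_Gamma {z : ℂ} (hz : Gamma z ≠ 0) :
    1 / ((exp (2 * Real.pi * I * z) - 1) * Gamma z) =
      exp (-(Real.pi * I * z)) * Gamma (1 - z) / (2 * Real.pi * I) := by
  have hreflection := Gamma_mul_Gamma_one_sub z
  have hpi : (Real.pi : ℂ) ≠ 0 := ofReal_ne_zero.2 Real.pi_ne_zero
  rw [exp_two_pi_mul_I_mul_sub_one, exp_neg]
  rcases eq_or_ne (sin (Real.pi * z)) 0 with hsin | hsin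
  · have : Gamma (1 - z) = 0 := by simpa [hsin, hz] using hreflection
    simp [hsin, this]
  · field_simp [hsin] at hreflection ⊢
    linear_combination -hreflection

theorem Gamma_one_sub_ne_zero_iff {s : ℂ} : Gamma (1 - s) ≠ 0 ↔ ∀ n : ℕ, s ≠ n + 1 := by
  rw [Ne, Gamma_eq_zero_iff, not_exists]
  refine forall_congr' fun n => not_congr ?_
  constructor <;> intro h <;> linear_combination -h

theorem isOpen_setOf_Gamma_one_sub_ne_zero : IsOpen {s : ℂ | Gamma (1 - s) ≠ 0} := by
  have hcont : Continuous fun s : ℂ => (Gamma (1 - s))⁻¹ :=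
    differentiable_one_div_Gamma.continuous.comp (continuous_sub_left 1)
  simpa only [ne_eq, inv_eq_zero] using isOpen_ne_fun hcont (continuous_const (y := 0))

theorem differentiableAt_Gamma_of_ne_zero {s : ℂ} (hs : Gamma s ≠ 0) :
    DifferentiableAt ℂ Gamma s :=
  differentiableAt_Gamma s fun m hm => hs ((Gamma_eq_zero_iff s).2 ⟨m, hm⟩)

theorem differentiableAt_exp_neg_mul_Gamma_one_sub {s : ℂ} (hs : Gamma (1 - s) ≠ 0) :
    DifferentiableAt ℂ
      (fun s => exp (-(Real.pi * I * s)) * Gamma (1 - s) / (2 * Real.pi * I)) s := by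
  have := (differentiableAt_Gamma_of_ne_zero hs).fun_comp' s
    (differentiableAt_id.const_sub (1 : ℂ))
  fun_prop

theorem eventually_Gamma_ne_zero (m : ℕ) : ∀ᶠ z in 𝓝[≠] (-m : ℂ), Gamma z ≠ 0 := by
  filter_upwards [self_mem_nhdsWithin,
    mem_nhdsWithin_of_mem_nhds (Metric.ball_mem_nhds (-m : ℂ) one_pos)] with z hz hball
  rw [Ne, Gamma_eq_zero_iff]
  rintro ⟨n, rfl⟩
  have hlt : ‖((m - n : ℤ) : ℂ)‖ < 1 := by
    simpa [dist_eq_norm, sub_eq_add_neg, add_comm] using hball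
  rw [norm_intCast] at hlt
  have : (m - n : ℤ) = 0 := Int.abs_lt_one_iff.1 (by exact_mod_cast hlt)
  exact hz (by simp; omega)

theorem hankelFactor_eq {s : ℂ} (hs : Gamma (1 - s) ≠ 0) :
    hankelFactor s = exp (-(Real.pi * I * s)) * Gamma (1 - s) / (2 * Real.pi * I) := by
  rw [hankelFactor]
  split_ifs with h
  · obtain ⟨m, rfl⟩ := h
    refine Tendsto.limUnder_eq (Tendsto.congr' ?_ (tendsto_nhdsWithin_of_tendsto_nhds
      (differentiableAt_exp_neg_mul_Gamma_one_sub hs).continuousAt))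
    filter_upwards [eventually_Gamma_ne_zero m] with z hz
    exact (one_div_exp_sub_one_mul_Gamma hz).symm
  · exact one_div_exp_sub_one_mul_Gamma (mt (Gamma_eq_zero_iff s).1 h)

theorem differentiableAt_hankelFactor {s : ℂ} (hs : Gamma (1 - s) ≠ 0) :
    DifferentiableAt ℂ hankelFactor s :=
  (differentiableAt_exp_neg_mul_Gamma_one_sub hs).congr_of_eventuallyEq <| by
    filter_upwards [isOpen_setOf_Gamma_one_sub_ne_zero.mem_nhds hs] with z hz
    exact hankelFactor_eq hz

theorem hankelFactor_mul_exp_sub_one {s : ℂ} (hs : 0 < s.re) (hs' : Gamma (1 - s) ≠ 0) :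
    hankelFactor s * (exp (2 * Real.pi * I * s) - 1) = (Gamma s)⁻¹ := by
  have hΓ : Gamma s ≠ 0 := Gamma_ne_zero_of_re_pos hs
  have hreflection := Gamma_mul_Gamma_one_sub s
  have hsin : sin (Real.pi * s) ≠ 0 := fun h => by simp [h, hΓ, hs'] at hreflection
  rw [eq_div_iff hsin] at hreflection
  rw [hankelFactor_eq hs', exp_two_pi_mul_I_mul_sub_one, exp_neg]
  field_simp
  linear_combination hreflection

end HankelFactor

/-- The open `η`-neighbourhood of the half-line `[0, ∞)` in `ℂ`. -/
def tube (η : ℝ) : Set ℂ := Metric.thickening η (Complex.ofReal '' Set.Ici 0)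

section Tube

variable {η : ℝ}

theorem mem_tube_iff {t : ℂ} : t ∈ tube η ↔ ∃ x : ℝ, 0 ≤ x ∧ ‖t - x‖ < η := by
  simp [tube, Metric.mem_thickening_iff, dist_eq_norm]

theorem ofReal_mem_tube (hη : 0 < η) {x : ℝ} (hx : 0 ≤ x) : (x : ℂ) ∈ tube η :=
  mem_tube_iff.2 ⟨x, hx, by simpa using hη⟩

theorem mem_tube_of_norm_lt {t : ℂ} (ht : ‖t‖ < η) : t ∈ tube η :=
  mem_tube_iff.2 ⟨0, le_rfl, by simpa using ht⟩

end Tube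

/-- A holomorphic family, indexed by `s` in an open domain, of complex measures `density s u du`
on a curve in the tube of radius `η` against which every exponentially decaying function is
integrable, locally uniformly in `s`. The Hankel contour and the half-line `[0, ∞)`, with density
`t^{s-1} dt`, are the two cases of interest. -/
structure MellinChart (η : ℝ) where
  domain : Set ℂ
  point : ℝ → ℂ
  density : ℂ → ℝ → ℂ
  isOpen_domain : IsOpen domain
  continuous_point : Continuous point
  point_mem_tube : ∀ u, point u ∈ tube η
  measurable_density : ∀ s, Measurable (density s)
  differentiableAt_density : ∀ s ∈ domain, ∀ u, DifferentiableAt ℂ (density · u) s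
  exists_bound : ∀ s ∈ domain, ∀ Γ : ℂ, 0 < Γ.re → ∃ B : ℝ → ℝ, Integrable B ∧
    ∀ᶠ z in 𝓝 s, ∀ u, Real.exp (-(point u * Γ).re) * ‖density z u‖ ≤ B u

namespace MellinChart

variable {η : ℝ}

theorem integrable_exp_mul_norm_density (C : MellinChart η) {s Γ : ℂ} (hs : s ∈ C.domain)
    (hΓ : 0 < Γ.re) :
    Integrable fun u => Real.exp (-(C.point u * Γ).re) * ‖C.density s u‖ := by
  obtain ⟨B, hB, hbound⟩ := C.exists_bound s hs Γ hΓ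
  refine hB.mono' (Measurable.aestronglyMeasurable ?_) (ae_of_all _ fun u => ?_)
  · have := C.continuous_point.measurable
    have := C.measurable_density s
    fun_prop
  · rw [Real.norm_of_nonneg (by positivity)]
    exact hbound.self_of_nhds u

/-- The chart whose density is multiplied by `a s`, for `a` holomorphic on the open set `Ω`. -/
@[simps]
def scale (C : MellinChart η) (a : ℂ → ℂ) (Ω : Set ℂ) (hΩ : IsOpen Ω)
    (ha : ∀ s ∈ Ω, DifferentiableAt ℂ a s) : MellinChart η where
  domain := C.domain ∩ Ω
  point := C.point
  density s u := a s * C.density s u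
  isOpen_domain := C.isOpen_domain.inter hΩ
  continuous_point := C.continuous_point
  point_mem_tube := C.point_mem_tube
  measurable_density s := (C.measurable_density s).const_mul _
  differentiableAt_density s hs u := (ha s hs.2).mul (C.differentiableAt_density s hs.1 u)
  exists_bound s hs Γ hΓ := by
    obtain ⟨B, hB, hbound⟩ := C.exists_bound s hs.1 Γ hΓ
    refine ⟨fun u => (‖a s‖ + 1) * B u, hB.const_mul _, ?_⟩
    filter_upwards [hbound, (ha s hs.2).continuousAt.norm.eventually_le_const
      (lt_add_one ‖a s‖)] with z hz haz u
    rw [norm_mul, mul_left_comm]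
    exact mul_le_mul haz (hz u) (by positivity) (by positivity)

end MellinChart

section HankelContour

variable {ε u : ℝ}

theorem hankelRadius_of_nonpos (hu : u ≤ 0) : hankelRadius ε u = ε - u := by
  rw [hankelRadius, max_eq_left (by linarith), max_eq_right (by linarith [Real.pi_pos])]
  ring

theorem hankelRadius_of_mem_Icc (hu : u ∈ Set.Icc 0 (2 * Real.pi)) : hankelRadius ε u = ε := by
  rw [hankelRadius, max_eq_right (by linarith [hu.1]), max_eq_right (by linarith [hu.2])]
  ring

theorem hankelRadius_of_ge (hu : 2 * Real.pi ≤ u) :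
    hankelRadius ε u = ε + (u - 2 * Real.pi) := by
  rw [hankelRadius, max_eq_right (by linarith [Real.pi_pos]), max_eq_left (by linarith)]
  ring

theorem hankelAngle_of_nonpos (hu : u ≤ 0) : hankelAngle u = 0 := by
  rw [hankelAngle, max_eq_left ((min_le_left _ _).trans hu)]

theorem hankelAngle_of_mem_Icc (hu : u ∈ Set.Icc 0 (2 * Real.pi)) : hankelAngle u = u := by
  rw [hankelAngle, min_eq_left hu.2, max_eq_right hu.1]

theorem hankelAngle_of_ge (hu : 2 * Real.pi ≤ u) : hankelAngle u = 2 * Real.pi := by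
  rw [hankelAngle, min_eq_right hu, max_eq_right (by positivity)]

theorem hankelPoint_of_nonpos (hu : u ≤ 0) : hankelPoint ε u = (ε - u : ℝ) := by
  simp [hankelPoint, hankelRadius_of_nonpos hu, hankelAngle_of_nonpos hu]

theorem hankelPoint_of_mem_Icc (hu : u ∈ Set.Icc 0 (2 * Real.pi)) :
    hankelPoint ε u = ε * Complex.exp (Complex.I * u) := by
  rw [hankelPoint, hankelRadius_of_mem_Icc hu, hankelAngle_of_mem_Icc hu]

theorem hankelPoint_of_ge (hu : 2 * Real.pi ≤ u) :
    hankelPoint ε u = (ε + (u - 2 * Real.pi) : ℝ) := by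
  rw [hankelPoint, hankelRadius_of_ge hu, hankelAngle_of_ge hu, mul_comm Complex.I]
  simp

theorem norm_hankelPoint_of_mem_Icc (hε : 0 < ε) (hu : u ∈ Set.Icc 0 (2 * Real.pi)) :
    ‖hankelPoint ε u‖ = ε := by
  rw [hankelPoint_of_mem_Icc hu, norm_mul, Complex.norm_exp_I_mul_ofReal, mul_one,
    Complex.norm_of_nonneg hε.le]

theorem hankelPoint_mem_tube {η : ℝ} (hε : 0 < ε) (hεη : ε < η) (u : ℝ) :
    hankelPoint ε u ∈ tube η := by
  rcases le_total u 0 with h0 | h0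
  · rw [hankelPoint_of_nonpos h0]
    exact ofReal_mem_tube (hε.trans hεη) (by linarith)
  rcases le_total u (2 * Real.pi) with h1 | h1
  · exact mem_tube_of_norm_lt (by rwa [norm_hankelPoint_of_mem_Icc hε ⟨h0, h1⟩])
  · rw [hankelPoint_of_ge h1]
    exact ofReal_mem_tube (hε.trans hεη) (by linarith)

/-- The density of `t^{s-1} dt` with respect to `du` on the Hankel contour. -/
noncomputable def contourWeight (ε : ℝ) (s : ℂ) (u : ℝ) : ℂ :=
  hankelPow ε u (s - 1) * hankelVelocity ε u

theorem continuous_hankelRadius : Continuous (hankelRadius ε) := by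
  unfold hankelRadius
  fun_prop

theorem continuous_hankelAngle : Continuous hankelAngle := by
  unfold hankelAngle
  fun_prop

theorem continuous_hankelPoint : Continuous (hankelPoint ε) := by
  have := continuous_hankelRadius (ε := ε)
  have := continuous_hankelAngle
  unfold hankelPoint
  fun_prop

theorem measurable_contourWeight (s : ℂ) : Measurable (contourWeight ε s) := by
  have hradius := (continuous_hankelRadius (ε := ε)).measurable
  have hangle := continuous_hankelAngle.measurable
  have hvelocity : Measurable (hankelVelocity ε) :=
    .ite measurableSet_Iio measurable_const (.ite measurableSet_Iic (by fun_prop) measurable_const)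
  unfold contourWeight hankelPow
  fun_prop

theorem le_hankelRadius (ε u : ℝ) : ε ≤ hankelRadius ε u := by
  unfold hankelRadius
  linarith [le_max_right (-u) 0, le_max_right (u - 2 * Real.pi) 0]

theorem abs_sub_two_pi_le_hankelRadius (hε : 0 < ε) (u : ℝ) :
    |u| - 2 * Real.pi ≤ hankelRadius ε u := by
  unfold hankelRadius
  rcases abs_cases u with ⟨h, -⟩ | ⟨h, -⟩ <;>
    linarith [Real.pi_pos, le_max_left (-u) 0, le_max_left (u - 2 * Real.pi) 0,
      le_max_right (-u) 0, le_max_right (u - 2 * Real.pi) 0]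

theorem norm_hankelVelocity_le (hε : 0 < ε) (u : ℝ) : ‖hankelVelocity ε u‖ ≤ 1 + ε := by
  unfold hankelVelocity
  split_ifs
  · simp [hε.le]
  · rw [norm_mul, Complex.norm_exp_I_mul_ofReal, norm_mul]
    simp [abs_of_pos hε]
  · simp [hε.le]

theorem norm_hankelPow_le (ε u : ℝ) (a : ℂ) :
    ‖hankelPow ε u a‖ ≤ Real.exp (‖a‖ * (|Real.log (hankelRadius ε u)| + 2 * Real.pi)) := by
  have hangle : |hankelAngle u| ≤ 2 * Real.pi := by
    rw [hankelAngle, abs_of_nonneg (le_max_left _ _)]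
    exact max_le (by positivity) (min_le_right _ _)
  rw [hankelPow, Complex.norm_exp, Real.exp_le_exp]
  refine (Complex.re_le_norm _).trans ?_
  rw [norm_mul]
  gcongr
  refine (norm_add_le _ _).trans ?_
  simpa using hangle

theorem exists_abs_log_le (hε : 0 < ε) {κ : ℝ} (hκ : 0 < κ) :
    ∃ L, ∀ x, ε ≤ x → |Real.log x| ≤ κ * x + L := by
  refine ⟨|Real.log κ| + |Real.log ε|, fun x hx => abs_le.2 ⟨?_, ?_⟩⟩
  · have := mul_pos hκ (hε.trans_le hx)
    linarith [Real.log_le_log hε hx, neg_abs_le (Real.log ε), abs_nonneg (Real.log κ)]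
  · have h := Real.log_le_sub_one_of_pos (mul_pos hκ (hε.trans_le hx))
    rw [Real.log_mul hκ.ne' (hε.trans_le hx).ne'] at h
    linarith [neg_abs_le (Real.log κ), abs_nonneg (Real.log ε)]

theorem re_hankelPoint_mul_ge (hε : 0 < ε) (Γ : ℂ) (u : ℝ) :
    Γ.re * hankelRadius ε u - 2 * ε * ‖Γ‖ ≤ (hankelPoint ε u * Γ).re := by
  have hpos : 0 ≤ 2 * ε * ‖Γ‖ := by positivity
  rcases le_total u 0 with h0 | h0
  · rw [hankelPoint_of_nonpos h0, hankelRadius_of_nonpos h0, Complex.re_ofReal_mul]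
    linarith
  rcases le_total u (2 * Real.pi) with h1 | h1
  · have hnorm : ‖hankelPoint ε u * Γ‖ = ε * ‖Γ‖ := by
      rw [norm_mul, norm_hankelPoint_of_mem_Icc hε ⟨h0, h1⟩]
    have hre := (abs_le.1 (Complex.abs_re_le_norm (hankelPoint ε u * Γ))).1
    rw [hankelRadius_of_mem_Icc ⟨h0, h1⟩]
    linarith [mul_le_mul_of_nonneg_left (Complex.re_le_norm Γ) hε.le]
  · rw [hankelPoint_of_ge h1, hankelRadius_of_ge h1, Complex.re_ofReal_mul]
    linarith

theorem exists_exp_mul_norm_contourWeight_le (hε : 0 < ε) {Γ : ℂ} (hΓ : 0 < Γ.re) {N : ℝ}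
    (hN : 0 < N) :
    ∃ K : ℝ, ∀ s : ℂ, ‖s - 1‖ ≤ N → ∀ u : ℝ,
      Real.exp (-(hankelPoint ε u * Γ).re) * ‖contourWeight ε s u‖
        ≤ K * Real.exp (-(Γ.re / 2) * |u|) := by
  obtain ⟨L, hL⟩ := exists_abs_log_le hε (κ := Γ.re / 2 / N) (by positivity)
  refine ⟨Real.exp (2 * ε * ‖Γ‖ + N * (L + 2 * Real.pi) + Γ.re * Real.pi) * (1 + ε),
    fun s hs u => ?_⟩
  set R := hankelRadius ε u
  have hlog : ‖s - 1‖ * (|Real.log R| + 2 * Real.pi) ≤ Γ.re / 2 * R + N * (L + 2 * Real.pi) :=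
    calc ‖s - 1‖ * (|Real.log R| + 2 * Real.pi)
        ≤ N * (Γ.re / 2 / N * R + L + 2 * Real.pi) := by gcongr; exact hL R (le_hankelRadius ε u)
      _ = Γ.re / 2 * R + N * (L + 2 * Real.pi) := by field_simp; ring
  have hradius : Γ.re / 2 * (|u| - 2 * Real.pi) ≤ Γ.re / 2 * R := by
    gcongr
    exact abs_sub_two_pi_le_hankelRadius hε u
  rw [contourWeight, norm_mul, ← mul_assoc]
  calc Real.exp (-(hankelPoint ε u * Γ).re) * ‖hankelPow ε u (s - 1)‖ * ‖hankelVelocity ε u‖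
      ≤ Real.exp (-(Γ.re * R - 2 * ε * ‖Γ‖)) *
          Real.exp (Γ.re / 2 * R + N * (L + 2 * Real.pi)) * (1 + ε) := by
        gcongr
        · exact re_hankelPoint_mul_ge hε Γ u
        · exact (norm_hankelPow_le ε u _).trans (Real.exp_le_exp.2 hlog)
        · exact norm_hankelVelocity_le hε u
    _ ≤ Real.exp (2 * ε * ‖Γ‖ + N * (L + 2 * Real.pi) + Γ.re * Real.pi) *
          Real.exp (-(Γ.re / 2) * |u|) * (1 + ε) := by
        refine mul_le_mul_of_nonneg_right ?_ (by positivity)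
        rw [← Real.exp_add, ← Real.exp_add, Real.exp_le_exp]
        linarith
    _ = _ := by ring

theorem integrable_exp_neg_mul_abs {b : ℝ} (hb : 0 < b) :
    Integrable fun u : ℝ => Real.exp (-b * |u|) := by
  have hIoi : IntegrableOn (fun u : ℝ => Real.exp (-b * |u|)) (Set.Ioi 0) := by
    refine (integrableOn_exp_mul_Ioi (neg_lt_zero.2 hb) 0).congr_fun (fun x hx => ?_)
      measurableSet_Ioi
    simp [abs_of_pos (Set.mem_Ioi.1 hx)]
  have hIic : IntegrableOn (fun u : ℝ => Real.exp (-b * |u|)) (Set.Iic 0) := by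
    refine (integrableOn_exp_mul_Iic hb 0).congr_fun (fun x hx => ?_) measurableSet_Iic
    simp [abs_of_nonpos (Set.mem_Iic.1 hx)]
  rw [← integrableOn_univ, ← Set.Iic_union_Ioi]
  exact hIic.union hIoi

/-- The Hankel contour with density `t^{s-1} dt`. -/
@[simps]
noncomputable def hankelChart {η : ℝ} (ε : ℝ) (hε : 0 < ε) (hεη : ε < η) : MellinChart η where
  domain := Set.univ
  point := hankelPoint ε
  density := contourWeight ε
  isOpen_domain := isOpen_univ
  continuous_point := continuous_hankelPoint
  point_mem_tube := hankelPoint_mem_tube hε hεη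
  measurable_density := measurable_contourWeight
  differentiableAt_density s _ u := by
    unfold contourWeight hankelPow
    fun_prop
  exists_bound s _ Γ hΓ := by
    obtain ⟨K, hK⟩ := exists_exp_mul_norm_contourWeight_le hε hΓ (N := ‖s - 1‖ + 1) (by positivity)
    refine ⟨_, (integrable_exp_neg_mul_abs (half_pos hΓ)).const_mul K, ?_⟩
    have hcont : Continuous fun z : ℂ => ‖z - 1‖ := by fun_prop
    filter_upwards [hcont.continuousAt.eventually_le_const (lt_add_one ‖s - 1‖)] with z hz
    exact hK z hz

end HankelContour

section Ray

theorem integrableOn_exp_mul_rpow_Ioi {b σ : ℝ} (hb : 0 < b) (hσ : 0 < σ) :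
    IntegrableOn (fun x : ℝ => Real.exp (-(x * b)) * x ^ (σ - 1)) (Set.Ioi 0) := by
  have h := integrableOn_rpow_mul_exp_neg_mul_rpow (by linarith : -1 < σ - 1) one_pos hb
  refine h.congr_fun (fun x _ => ?_) measurableSet_Ioi
  simp only [Real.rpow_one]
  ring_nf

theorem rpow_le_rpow_add_rpow {x p a q : ℝ} (hx : 0 < x) (hpa : p ≤ a) (haq : a ≤ q) :
    x ^ a ≤ x ^ p + x ^ q := by
  rcases le_total x 1 with h | h
  · exact (Real.rpow_le_rpow_of_exponent_ge hx h hpa).trans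
      (le_add_of_nonneg_right (by positivity))
  · exact (Real.rpow_le_rpow_of_exponent_le h haq).trans
      (le_add_of_nonneg_left (by positivity))

/-- The half-line `(0, ∞)` with density `t^{s-1} dt`. -/
@[simps]
noncomputable def rayChart {η : ℝ} (hη : 0 < η) : MellinChart η where
  domain := {s | 0 < s.re}
  point u := (max u 0 : ℝ)
  density s := (Set.Ioi 0).indicator fun u : ℝ => (u : ℂ) ^ (s - 1)
  isOpen_domain := isOpen_lt continuous_const Complex.continuous_re
  continuous_point := by fun_prop
  point_mem_tube u := ofReal_mem_tube hη (le_max_right u 0)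
  measurable_density s :=
    (Complex.measurable_ofReal.pow_const (s - 1)).indicator measurableSet_Ioi
  differentiableAt_density s _ u := by
    by_cases hu : u ∈ Set.Ioi (0 : ℝ)
    · simp only [Set.indicator_of_mem hu]
      exact (differentiableAt_id.sub_const 1).const_cpow
        (Or.inl (Complex.ofReal_ne_zero.2 (ne_of_gt hu)))
    · simp only [Set.indicator_of_notMem hu, differentiableAt_const]
  exists_bound s hs Γ hΓ := by
    have hs : 0 < s.re := hs
    refine ⟨(Set.Ioi 0).indicator fun x : ℝ => Real.exp (-(x * Γ.re)) * x ^ (s.re / 2 - 1) +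
      Real.exp (-(x * Γ.re)) * x ^ (2 * s.re - 1), ?_, ?_⟩
    · exact (integrable_indicator_iff measurableSet_Ioi).2
        ((integrableOn_exp_mul_rpow_Ioi hΓ (by positivity)).add
          (integrableOn_exp_mul_rpow_Ioi hΓ (by positivity)))
    · filter_upwards [Complex.continuous_re.continuousAt.eventually_const_le (half_lt_self hs),
        Complex.continuous_re.continuousAt.eventually_le_const (show s.re < 2 * s.re by linarith)]
        with z hz hz' u
      by_cases hu : u ∈ Set.Ioi (0 : ℝ)
      · rw [Set.indicator_of_mem hu, Set.indicator_of_mem hu, max_eq_left hu.le, ← mul_add,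
          Complex.re_ofReal_mul, Complex.norm_cpow_eq_rpow_re_of_pos hu]
        gcongr
        exact rpow_le_rpow_add_rpow hu (by simpa using hz) (by simpa using hz')
      · simp [Set.indicator_of_notMem hu]

end Ray

/-- Holomorphy on the tube of radius `η` together with exponential decay `O(exp(-Re (t Γ)))` for
some `Γ` with positive real part. -/
structure TubeDecay (η : ℝ) (g : ℂ → ℂ) : Prop where
  differentiableAt : ∀ t ∈ tube η, DifferentiableAt ℂ g t
  exists_bound : ∃ Γ : ℂ, ∃ A : ℝ, 0 < Γ.re ∧
    ∀ t ∈ tube η, ‖g t‖ ≤ A * Real.exp (-(t * Γ).re)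

section OneVariable

variable {ε ε' η : ℝ} {g : ℂ → ℂ} {s : ℂ}

theorem TubeDecay.continuousOn (hg : TubeDecay η g) : ContinuousOn g (tube η) :=
  fun t ht => (hg.differentiableAt t ht).continuousAt.continuousWithinAt

theorem MellinChart.measurable_comp_mul_density (C : MellinChart η)
    (hg : ContinuousOn g (tube η)) (s : ℂ) :
    Measurable fun u => g (C.point u) * C.density s u :=
  (hg.comp_continuous C.continuous_point C.point_mem_tube).measurable.mul (C.measurable_density s)

/-- The integral of `g` over the curve of `C` against its density. -/
noncomputable def MellinChart.integral (C : MellinChart η) (g : ℂ → ℂ) (s : ℂ) : ℂ :=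
  ∫ u, g (C.point u) * C.density s u

theorem MellinChart.integrable_mul_density (C : MellinChart η) (hg : TubeDecay η g)
    (hs : s ∈ C.domain) : Integrable fun u => g (C.point u) * C.density s u := by
  obtain ⟨Γ, A, hΓ, hA⟩ := hg.exists_bound
  refine ((C.integrable_exp_mul_norm_density hs hΓ).const_mul A).mono'
    (C.measurable_comp_mul_density hg.continuousOn s).aestronglyMeasurable
    (ae_of_all _ fun u => ?_)
  rw [norm_mul, ← mul_assoc]
  exact mul_le_mul_of_nonneg_right (hA _ (C.point_mem_tube u)) (norm_nonneg _)

/-- The integrand `g(t) t^{s-1}` of the Mellin transform. -/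
noncomputable def rayIntegrand (g : ℂ → ℂ) (s : ℂ) (x : ℝ) : ℂ := g x * (x : ℂ) ^ (s - 1)

/-- The integral of `g(t) t^{s-1} dt` over the Hankel contour. -/
noncomputable def contourIntegral (ε : ℝ) (g : ℂ → ℂ) (s : ℂ) : ℂ :=
  ∫ u, g (hankelPoint ε u) * contourWeight ε s u

/-- The contribution of the circle to the Hankel integral. -/
noncomputable def circlePart (ε : ℝ) (g : ℂ → ℂ) (s : ℂ) : ℂ :=
  ∫ u in (0 : ℝ)..2 * Real.pi, g (hankelPoint ε u) * contourWeight ε s u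

/-- The pullback of `g(t) t^{s-1} dt` under `t = exp z`. -/
noncomputable def logPullback (g : ℂ → ℂ) (s z : ℂ) : ℂ :=
  g (Complex.exp z) * Complex.exp (s * z)

theorem comp_mul_contourWeight_of_neg (hε : 0 < ε) {u : ℝ} (hu : u < 0) :
    g (hankelPoint ε u) * contourWeight ε s u = -rayIntegrand g s (ε - u) := by
  have hx : ((ε - u : ℝ) : ℂ) ≠ 0 := Complex.ofReal_ne_zero.2 (by linarith)
  rw [rayIntegrand, Complex.cpow_def_of_ne_zero hx, ← Complex.ofReal_log (by linarith),
    contourWeight, hankelPow, hankelRadius_of_nonpos hu.le, hankelAngle_of_nonpos hu.le,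
    hankelVelocity, if_pos hu, hankelPoint_of_nonpos hu.le, mul_comm (s - 1)]
  simp

theorem comp_mul_contourWeight_of_gt (hε : 0 < ε) {u : ℝ} (hu : 2 * Real.pi < u) :
    g (hankelPoint ε u) * contourWeight ε s u =
      Complex.exp (2 * Real.pi * Complex.I * s) * rayIntegrand g s (ε + (u - 2 * Real.pi)) := by
  have hx : ((ε + (u - 2 * Real.pi) : ℝ) : ℂ) ≠ 0 := Complex.ofReal_ne_zero.2 (by linarith)
  have hexp : (s - 1) * ((Real.log (ε + (u - 2 * Real.pi)) : ℂ) +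
      Complex.I * ((2 * Real.pi : ℝ) : ℂ)) = (2 * Real.pi * Complex.I * s +
      (Real.log (ε + (u - 2 * Real.pi)) : ℂ) * (s - 1)) - 2 * Real.pi * Complex.I := by
    push_cast; ring
  rw [rayIntegrand, Complex.cpow_def_of_ne_zero hx, ← Complex.ofReal_log (by linarith),
    contourWeight, hankelPow, hankelRadius_of_ge hu.le, hankelAngle_of_ge hu.le, hankelVelocity,
    if_neg (by linarith [Real.pi_pos]), if_neg hu.not_ge, hankelPoint_of_ge hu.le, hexp,
    Complex.exp_periodic.sub_eq, Complex.exp_add]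
  ring

theorem comp_mul_contourWeight_of_mem_Icc (hε : 0 < ε) {u : ℝ}
    (hu : u ∈ Set.Icc 0 (2 * Real.pi)) :
    g (hankelPoint ε u) * contourWeight ε s u =
      Complex.I * logPullback g s (Real.log ε + u * Complex.I) := by
  have hpoint : Complex.exp (Real.log ε + u * Complex.I) = ε * Complex.exp (Complex.I * u) := by
    rw [Complex.exp_add, ← Complex.ofReal_exp, Real.exp_log hε, mul_comm (u : ℂ)]
  have hpow : Complex.exp (s * (Real.log ε + u * Complex.I)) =
      Complex.exp ((s - 1) * (Real.log ε + Complex.I * u)) *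
        (ε * Complex.exp (Complex.I * u)) := by
    rw [← hpoint, ← Complex.exp_add]
    ring_nf
  rw [contourWeight, hankelPow, hankelRadius_of_mem_Icc hu, hankelAngle_of_mem_Icc hu,
    hankelVelocity, if_neg hu.1.not_gt, if_pos hu.2, hankelPoint_of_mem_Icc hu, logPullback,
    hpoint, hpow]
  ring

theorem circlePart_eq_integral_logPullback (hε : 0 < ε) :
    circlePart ε g s = Complex.I * ∫ u in (0 : ℝ)..2 * Real.pi,
      logPullback g s (Real.log ε + u * Complex.I) := by
  rw [circlePart, ← intervalIntegral.integral_const_mul]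
  refine intervalIntegral.integral_congr fun u hu => ?_
  rw [Set.uIcc_of_le Real.two_pi_pos.le] at hu
  exact comp_mul_contourWeight_of_mem_Icc hε hu

theorem setIntegral_Iio_comp_sub_left (f : ℝ → ℂ) (ε : ℝ) :
    ∫ u in Set.Iio (0 : ℝ), f (ε - u) = ∫ x in Set.Ioi ε, f x := by
  rw [← (Measure.measurePreserving_sub_left volume ε).setIntegral_preimage_emb
    (Homeomorph.subLeft ε).measurableEmbedding _ (Set.Ioi ε), Set.preimage_const_sub_Ioi, sub_self]

theorem setIntegral_Ioi_comp_add_sub (f : ℝ → ℂ) (ε a : ℝ) :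
    ∫ u in Set.Ioi a, f (ε + (u - a)) = ∫ x in Set.Ioi ε, f x := by
  rw [← (measurePreserving_sub_right volume (a - ε)).setIntegral_preimage_emb
    (Homeomorph.subRight (a - ε)).measurableEmbedding _ (Set.Ioi ε), Set.preimage_sub_const_Ioi,
    add_sub_cancel]
  exact setIntegral_congr_fun measurableSet_Ioi fun u _ => congrArg f (by ring)

theorem integrableOn_rayIntegrand (hε : 0 < ε) (hεη : ε < η) (hg : TubeDecay η g) (s : ℂ) :
    IntegrableOn (rayIntegrand g s) (Set.Ioi ε) := by
  have hint := (hankelChart ε hε hεη).integrable_mul_density hg (Set.mem_univ s)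
  rw [← (Measure.measurePreserving_sub_left volume ε).integrableOn_comp_preimage
    (Homeomorph.subLeft ε).measurableEmbedding, Set.preimage_const_sub_Ioi, sub_self]
  refine (hint.neg.integrableOn (s := Set.Iio 0)).congr_fun (fun u hu => ?_) measurableSet_Iio
  simp [comp_mul_contourWeight_of_neg hε (Set.mem_Iio.1 hu)]

theorem contourIntegral_eq (hε : 0 < ε) (hεη : ε < η) (hg : TubeDecay η g) (s : ℂ) :
    contourIntegral ε g s = (Complex.exp (2 * Real.pi * Complex.I * s) - 1) *
      (∫ x in Set.Ioi ε, rayIntegrand g s x) + circlePart ε g s := by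
  have hint : Integrable fun u => g (hankelPoint ε u) * contourWeight ε s u :=
    (hankelChart ε hε hεη).integrable_mul_density hg (Set.mem_univ s)
  have htop : ∫ u in Set.Iio (0 : ℝ), g (hankelPoint ε u) * contourWeight ε s u =
      -∫ x in Set.Ioi ε, rayIntegrand g s x := by
    rw [← setIntegral_Iio_comp_sub_left, ← integral_neg]
    exact setIntegral_congr_fun measurableSet_Iio fun u hu => comp_mul_contourWeight_of_neg hε hu
  have hbottom : ∫ u in Set.Ioi (2 * Real.pi), g (hankelPoint ε u) * contourWeight ε s u =
      Complex.exp (2 * Real.pi * Complex.I * s) * ∫ x in Set.Ioi ε, rayIntegrand g s x := by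
    rw [← setIntegral_Ioi_comp_add_sub _ ε (2 * Real.pi), ← integral_const_mul]
    exact setIntegral_congr_fun measurableSet_Ioi fun u hu => comp_mul_contourWeight_of_gt hε hu
  rw [contourIntegral, ← intervalIntegral.integral_Iio_add_Ici hint.integrableOn hint.integrableOn,
    integral_Ici_eq_integral_Ioi, ← intervalIntegral.integral_interval_add_Ioi
      hint.integrableOn (hint.integrableOn (s := Set.Ioi (2 * Real.pi))), htop, hbottom, circlePart]
  ring

theorem exp_mem_tube (hε' : 0 < ε') (hεη' : ε' < η) {z : ℂ} (hz : z.re ≤ Real.log ε') :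
    Complex.exp z ∈ tube η := by
  refine mem_tube_of_norm_lt (lt_of_le_of_lt ?_ hεη')
  rwa [Complex.norm_exp, ← Real.le_log_iff_exp_le hε']

theorem integral_logPullback_ofReal (hε : 0 < ε) (hle : ε ≤ ε')
    (g : ℂ → ℂ) (hg : ContinuousOn (fun x : ℝ => g x) (Set.Icc ε ε')) (s : ℂ) :
    ∫ x in Real.log ε..Real.log ε', logPullback g s x = ∫ x in ε..ε', rayIntegrand g s x := by
  have hε' := hε.trans_le hle
  have himage : Real.exp '' Set.uIcc (Real.log ε) (Real.log ε') ⊆ Set.Icc ε ε' := by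
    rintro _ ⟨y, hy, rfl⟩
    rw [Set.uIcc_of_le (Real.log_le_log hε hle)] at hy
    exact ⟨(Real.log_le_iff_le_exp hε).1 hy.1, (Real.le_log_iff_exp_le hε').1 hy.2⟩
  have hcont : ContinuousOn (rayIntegrand g s) (Set.Icc ε ε') :=
    hg.mul (Complex.continuous_ofReal.continuousOn.cpow_const fun x hx =>
      Complex.ofReal_mem_slitPlane.2 (hε.trans_le hx.1))
  have hsubst := intervalIntegral.integral_deriv_smul_comp' (f := Real.exp) (f' := Real.exp)
    (fun x _ => Real.hasDerivAt_exp x) Real.continuous_exp.continuousOn (hcont.mono himage)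
  rw [Real.exp_log hε, Real.exp_log hε'] at hsubst
  rw [← hsubst]
  refine intervalIntegral.integral_congr fun x _ => ?_
  have hexp : Complex.exp (s * x) = Complex.exp x * Complex.exp (x * (s - 1)) := by
    rw [← Complex.exp_add]
    ring_nf
  simp only [Function.comp_apply, rayIntegrand, logPullback, Complex.real_smul, hexp,
    Complex.ofReal_exp, Complex.cpow_def_of_ne_zero (Complex.exp_ne_zero _)]
  rw [← Complex.ofReal_exp, ← Complex.ofReal_log (Real.exp_pos x).le, Real.log_exp]
  ring

theorem circlePart_sub_circlePart (hε : 0 < ε) (hle : ε ≤ ε') (hεη' : ε' < η)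
    (hg : TubeDecay η g) (s : ℂ) :
    circlePart ε g s - circlePart ε' g s =
      -(Complex.exp (2 * Real.pi * Complex.I * s) - 1) * ∫ x in ε..ε', rayIntegrand g s x := by
  have hε' := hε.trans_le hle
  have hrect := Complex.integral_boundary_rect_eq_zero_of_differentiableOn (logPullback g s)
    ⟨Real.log ε, 0⟩ ⟨Real.log ε', 2 * Real.pi⟩ fun z hz => by
      have hre := (Complex.mem_reProdIm.1 hz).1
      rw [Set.uIcc_of_le (Real.log_le_log hε hle)] at hre
      have hgz := hg.differentiableAt _ (exp_mem_tube hε' hεη' hre.2)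
      exact ((hgz.comp z Complex.differentiableAt_exp).mul
        (by fun_prop)).differentiableWithinAt
  have htop (x : ℝ) : logPullback g s (x + (2 * Real.pi : ℝ) * Complex.I) =
      Complex.exp (2 * Real.pi * Complex.I * s) * logPullback g s x := by
    have hperiod : Complex.exp (x + (2 * Real.pi : ℝ) * Complex.I) = Complex.exp x := by
      push_cast
      exact Complex.exp_periodic x
    rw [logPullback, logPullback, hperiod, mul_left_comm, ← Complex.exp_add]
    push_cast
    ring_nf
  have hcont : ContinuousOn (fun x : ℝ => g x) (Set.Icc ε ε') :=
    hg.continuousOn.comp Complex.continuous_ofReal.continuousOn fun x hx =>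
      ofReal_mem_tube (hε'.trans hεη') (hε.le.trans hx.1)
  simp only [Complex.ofReal_zero, zero_mul, add_zero, smul_eq_mul, htop,
    intervalIntegral.integral_const_mul, integral_logPullback_ofReal hε hle g hcont,
    ← circlePart_eq_integral_logPullback hε, ← circlePart_eq_integral_logPullback hε'] at hrect
  linear_combination -hrect

theorem contourIntegral_eq_of_le (hε : 0 < ε) (hle : ε ≤ ε') (hεη' : ε' < η)
    (hg : TubeDecay η g) (s : ℂ) : contourIntegral ε g s = contourIntegral ε' g s := by
  rw [contourIntegral_eq hε (hle.trans_lt hεη') hg, contourIntegral_eq (hε.trans_le hle) hεη' hg,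
    ← sub_eq_zero, add_sub_add_comm, circlePart_sub_circlePart hε hle hεη' hg s,
    ← intervalIntegral.integral_Ioi_sub_Ioi
      (integrableOn_rayIntegrand hε (hle.trans_lt hεη') hg s) hle]
  ring

theorem contourIntegral_eq_contourIntegral (hε : 0 < ε) (hεη : ε < η) (hε' : 0 < ε')
    (hεη' : ε' < η) (hg : TubeDecay η g) (s : ℂ) :
    contourIntegral ε g s = contourIntegral ε' g s := by
  rcases le_total ε ε' with hle | hle
  · exact contourIntegral_eq_of_le hε hle hεη' hg s
  · exact (contourIntegral_eq_of_le hε' hle hεη hg s).symm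

theorem norm_circlePart_le (hε : 0 < ε) {M : ℝ} (hM : ∀ t, ‖t‖ = ε → ‖g t‖ ≤ M) (s : ℂ) :
    ‖circlePart ε g s‖ ≤ M * Real.exp (|s.im| * (2 * Real.pi)) * (2 * Real.pi) * ε ^ s.re := by
  rw [circlePart_eq_integral_logPullback hε, norm_mul, Complex.norm_I, one_mul]
  have hbound : ∀ u ∈ Set.uIoc 0 (2 * Real.pi),
      ‖logPullback g s (Real.log ε + u * Complex.I)‖ ≤
        M * (ε ^ s.re * Real.exp (|s.im| * (2 * Real.pi))) := by
    intro u hu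
    rw [Set.uIoc_of_le Real.two_pi_pos.le] at hu
    have hnorm : ‖Complex.exp (Real.log ε + u * Complex.I)‖ = ε := by
      simp [Complex.norm_exp, Real.exp_log hε]
    have him : -(s.im * u) ≤ |s.im| * (2 * Real.pi) := by
      refine (neg_le_abs _).trans ?_
      rw [abs_mul, abs_of_pos hu.1]
      exact mul_le_mul_of_nonneg_left hu.2 (abs_nonneg _)
    rw [logPullback, norm_mul, Complex.norm_exp (s * _), Real.rpow_def_of_pos hε, ← Real.exp_add]
    refine mul_le_mul (hM _ hnorm) (Real.exp_le_exp.2 ?_) (by positivity)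
      ((norm_nonneg _).trans (hM _ hnorm))
    have hre : (s * (Real.log ε + u * Complex.I)).re = Real.log ε * s.re - s.im * u := by
      simp [mul_comm]
    linarith
  refine (intervalIntegral.norm_integral_le_of_norm_le_const hbound).trans_eq ?_
  rw [sub_zero, abs_of_pos Real.two_pi_pos]
  ring

theorem tendsto_circlePart (hη : 0 < η) (hg : TubeDecay η g) (hs : 0 < s.re) :
    Tendsto (fun ε => circlePart ε g s) (𝓝[>] 0) (𝓝 0) := by
  have hcont : ContinuousAt g 0 :=
    (hg.differentiableAt 0 (mem_tube_of_norm_lt (by simpa using hη))).continuousAt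
  obtain ⟨δ, hδ, hball⟩ := Metric.eventually_nhds_iff_ball.1
    (hcont.norm.eventually_le_const (lt_add_one ‖g 0‖))
  have hpow : Tendsto (fun ε : ℝ => ε ^ s.re) (𝓝[>] 0) (𝓝 0) := by
    simpa [Real.zero_rpow hs.ne'] using
      (Real.continuousAt_rpow_const 0 s.re (Or.inr hs.le)).tendsto.mono_left nhdsWithin_le_nhds
  have hmajorant := hpow.const_mul
    ((‖g 0‖ + 1) * Real.exp (|s.im| * (2 * Real.pi)) * (2 * Real.pi))
  rw [mul_zero] at hmajorant
  refine squeeze_zero_norm' ?_ hmajorant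
  filter_upwards [Ioo_mem_nhdsGT hδ] with ε hε
  exact norm_circlePart_le hε.1 (fun t ht => hball t (by simpa [ht] using hε.2)) s

theorem rayChart_mul_density (hη : 0 < η) (g : ℂ → ℂ) (s : ℂ) :
    (fun u => g ((rayChart hη).point u) * (rayChart hη).density s u) =
      (Set.Ioi 0).indicator (rayIntegrand g s) := by
  funext u
  by_cases hu : u ∈ Set.Ioi (0 : ℝ)
  · simp [hu, rayIntegrand, max_eq_left (Set.mem_Ioi.1 hu).le]
  · simp [hu]

theorem integral_rayChart (hη : 0 < η) (g : ℂ → ℂ) (s : ℂ) :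
    (rayChart hη).integral g s = ∫ x in Set.Ioi 0, rayIntegrand g s x := by
  rw [MellinChart.integral, rayChart_mul_density, integral_indicator measurableSet_Ioi]

theorem integrableOn_rayIntegrand_Ioi_zero (hη : 0 < η) (hg : TubeDecay η g) (hs : 0 < s.re) :
    IntegrableOn (rayIntegrand g s) (Set.Ioi 0) := by
  rw [← integrable_indicator_iff measurableSet_Ioi, ← rayChart_mul_density hη]
  exact (rayChart hη).integrable_mul_density hg hs

theorem contourIntegral_eq_mul_integral_rayIntegrand (hε : 0 < ε) (hεη : ε < η)
    (hg : TubeDecay η g) (hs : 0 < s.re) :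
    contourIntegral ε g s = (Complex.exp (2 * Real.pi * Complex.I * s) - 1) *
      ∫ x in Set.Ioi 0, rayIntegrand g s x := by
  have hη := hε.trans hεη
  have hray : Tendsto (fun ρ => ∫ x in Set.Ioi ρ, rayIntegrand g s x) (𝓝[>] 0)
      (𝓝 (∫ x in Set.Ioi 0, rayIntegrand g s x)) :=
    (integrableOn_rayIntegrand_Ioi_zero hη hg hs).continuousWithinAt_Ici_primitive_Ioi.mono_left
      (nhdsWithin_mono 0 Set.Ioi_subset_Ici_self)
  have hlim := (hray.const_mul (Complex.exp (2 * Real.pi * Complex.I * s) - 1)).add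
    (tendsto_circlePart hη hg hs)
  rw [add_zero] at hlim
  refine tendsto_nhds_unique (tendsto_const_nhds.congr' ?_) hlim
  filter_upwards [Ioo_mem_nhdsGT hη] with ρ hρ
  rw [contourIntegral_eq_contourIntegral hε hεη hρ.1 hρ.2 hg, contourIntegral_eq hρ.1 hρ.2 hg]

end OneVariable

section Normalized

variable {η : ℝ} {g : ℂ → ℂ} {s : ℂ}

theorem MellinChart.integral_scale (C : MellinChart η) (a : ℂ → ℂ) (Ω : Set ℂ) (hΩ : IsOpen Ω)
    (ha : ∀ s ∈ Ω, DifferentiableAt ℂ a s) (g : ℂ → ℂ) (s : ℂ) :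
    (C.scale a Ω hΩ ha).integral g s = a s * C.integral g s := by
  simp only [MellinChart.integral, MellinChart.scale_point, MellinChart.scale_density,
    ← integral_const_mul, mul_left_comm]

/-- The charts with densities `(Γ s)⁻¹ t^{s-1} dt` on the half-line (index `none`) and
`hankelFactor s * t^{s-1} dt` on the Hankel contour of radius `ε` (index `some ε`). Their domains
cover `ℂ`, and on the overlaps they define the same functional. -/
noncomputable def normalizedChart (hη : 0 < η) : Option (Set.Ioo 0 η) → MellinChart η
  | none => (rayChart hη).scale (fun s => (Complex.Gamma s)⁻¹) Set.univ isOpen_univ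
      fun s _ => Complex.differentiable_one_div_Gamma s
  | some ε => (hankelChart ε ε.2.1 ε.2.2).scale hankelFactor {s | Complex.Gamma (1 - s) ≠ 0}
      isOpen_setOf_Gamma_one_sub_ne_zero fun _ hs => differentiableAt_hankelFactor hs

theorem mem_domain_normalizedChart_none (hη : 0 < η) :
    s ∈ (normalizedChart hη none).domain ↔ 0 < s.re := by
  simp [normalizedChart]

theorem mem_domain_normalizedChart_some (hη : 0 < η) (ε : Set.Ioo 0 η) :
    s ∈ (normalizedChart hη (some ε)).domain ↔ Complex.Gamma (1 - s) ≠ 0 := by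
  simp [normalizedChart]

theorem exists_mem_domain_normalizedChart (hη : 0 < η) (s : ℂ) :
    ∃ i, s ∈ (normalizedChart hη i).domain := by
  by_cases hs : 0 < s.re
  · exact ⟨none, (mem_domain_normalizedChart_none hη).2 hs⟩
  · refine ⟨some ⟨η / 2, half_pos hη, half_lt_self hη⟩,
      (mem_domain_normalizedChart_some hη _).2 (Complex.Gamma_ne_zero_of_re_pos ?_)⟩
    simpa using (not_lt.1 hs).trans_lt one_pos

theorem integral_normalizedChart_some (hη : 0 < η) (hg : TubeDecay η g) (ε ε' : Set.Ioo 0 η) :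
    (normalizedChart hη (some ε)).integral g s = (normalizedChart hη (some ε')).integral g s := by
  simp only [normalizedChart, MellinChart.integral_scale]
  exact congrArg _ (contourIntegral_eq_contourIntegral ε.2.1 ε.2.2 ε'.2.1 ε'.2.2 hg s)

theorem integral_normalizedChart_some_eq_none (hη : 0 < η) (hg : TubeDecay η g)
    (ε : Set.Ioo 0 η) (hs : 0 < s.re) (hΓ : Complex.Gamma (1 - s) ≠ 0) :
    (normalizedChart hη (some ε)).integral g s = (normalizedChart hη none).integral g s := by
  simp only [normalizedChart, MellinChart.integral_scale, integral_rayChart]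
  rw [← hankelFactor_mul_exp_sub_one hs hΓ, mul_assoc]
  exact congrArg _ (contourIntegral_eq_mul_integral_rayIntegrand ε.2.1 ε.2.2 hg hs)

theorem integral_normalizedChart_eq (hη : 0 < η) (hg : TubeDecay η g)
    {i j : Option (Set.Ioo 0 η)} (hi : s ∈ (normalizedChart hη i).domain)
    (hj : s ∈ (normalizedChart hη j).domain) :
    (normalizedChart hη i).integral g s = (normalizedChart hη j).integral g s := by
  rcases i with _ | ε <;> rcases j with _ | ε' <;>
    simp only [mem_domain_normalizedChart_none, mem_domain_normalizedChart_some] at hi hj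
  · rfl
  · exact (integral_normalizedChart_some_eq_none hη hg ε' hi hj).symm
  · exact integral_normalizedChart_some_eq_none hη hg ε hj hi
  · exact integral_normalizedChart_some hη hg ε ε'

end Normalized

section SeveralVariables

variable {ι : Type*} {η : ℝ}

/-- The polytube: the product of tubes of radius `η`. -/
def polytube (ι : Type*) (η : ℝ) : Set (ι → ℂ) := {t | ∀ k, t k ∈ tube η}

/-- The point with parameters `u` on the product of the curves of the charts `C k`. -/
def chartPoints (C : ι → MellinChart η) (u : ι → ℝ) : ι → ℂ := fun k => (C k).point (u k)

theorem chartPoints_mem_polytube (C : ι → MellinChart η) (u : ι → ℝ) :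
    chartPoints C u ∈ polytube ι η :=
  fun k => (C k).point_mem_tube (u k)

theorem continuous_chartPoints (C : ι → MellinChart η) : Continuous (chartPoints C) :=
  continuous_pi fun k => (C k).continuous_point.comp (continuous_apply k)

theorem chartPoints_update [DecidableEq ι] (C : ι → MellinChart η) (k : ι) (D : MellinChart η)
    (u : ι → ℝ) (x : ℝ) : chartPoints (Function.update C k D) (Function.update u k x) =
      Function.update (chartPoints C u) k (D.point x) := by
  funext j
  rcases eq_or_ne j k with rfl | hj
  · simp [chartPoints]
  · simp [chartPoints, hj]

variable [Fintype ι]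

/-- Holomorphy on the polytube of radius `η` together with exponential decay in each variable. -/
structure PolytubeDecay (η : ℝ) (f : (ι → ℂ) → ℂ) : Prop where
  differentiableAt : ∀ t ∈ polytube ι η, DifferentiableAt ℂ f t
  exists_bound : ∃ Γ : ι → ℂ, ∃ A : ℝ, (∀ k, 0 < (Γ k).re) ∧
    ∀ t ∈ polytube ι η, ‖f t‖ ≤ A * ∏ k, Real.exp (-(t k * Γ k).re)

/-- The product of the densities of the charts `C k`. -/
noncomputable def chartDensity (C : ι → MellinChart η) (s : ι → ℂ) (u : ι → ℝ) : ℂ :=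
  ∏ k, (C k).density (s k) (u k)

/-- The integral of `f` over the product of the curves of the charts `C k` against the product of
their densities. -/
noncomputable def chartIntegral (C : ι → MellinChart η) (f : (ι → ℂ) → ℂ) (s : ι → ℂ) : ℂ :=
  ∫ u, f (chartPoints C u) * chartDensity C s u

theorem measurable_chartDensity (C : ι → MellinChart η) (s : ι → ℂ) :
    Measurable (chartDensity C s) :=
  Finset.measurable_prod _ fun k _ =>
    ((C k).measurable_density (s k)).comp (measurable_pi_apply k)

theorem integrable_prod_exp_mul_norm_chartDensity (C : ι → MellinChart η) {s Γ : ι → ℂ}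
    (hs : ∀ k, s k ∈ (C k).domain) (hΓ : ∀ k, 0 < (Γ k).re) :
    Integrable fun u =>
      (∏ k, Real.exp (-(chartPoints C u k * Γ k).re)) * ‖chartDensity C s u‖ := by
  simp only [chartDensity, norm_prod, ← Finset.prod_mul_distrib]
  exact Integrable.fintype_prod fun k => (C k).integrable_exp_mul_norm_density (hs k) (hΓ k)

variable {f : (ι → ℂ) → ℂ} {s : ι → ℂ}

theorem PolytubeDecay.continuousOn (hf : PolytubeDecay η f) : ContinuousOn f (polytube ι η) :=
  fun t ht => (hf.differentiableAt t ht).continuousAt.continuousWithinAt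

theorem PolytubeDecay.measurable_comp_mul_chartDensity (hf : PolytubeDecay η f)
    (C : ι → MellinChart η) (s : ι → ℂ) :
    Measurable fun u => f (chartPoints C u) * chartDensity C s u :=
  (hf.continuousOn.comp_continuous (continuous_chartPoints C)
    (chartPoints_mem_polytube C)).measurable.mul (measurable_chartDensity C s)

theorem PolytubeDecay.integrable_mul_chartDensity (hf : PolytubeDecay η f)
    (C : ι → MellinChart η) (hs : ∀ k, s k ∈ (C k).domain) :
    Integrable fun u => f (chartPoints C u) * chartDensity C s u := by
  obtain ⟨Γ, A, hΓ, hA⟩ := hf.exists_bound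
  refine ((integrable_prod_exp_mul_norm_chartDensity C hs hΓ).const_mul A).mono'
    (hf.measurable_comp_mul_chartDensity C s).aestronglyMeasurable (ae_of_all _ fun u => ?_)
  rw [norm_mul, ← mul_assoc]
  exact mul_le_mul_of_nonneg_right (hA _ (chartPoints_mem_polytube C u)) (norm_nonneg _)

theorem differentiableAt_chartDensity (C : ι → MellinChart η) (hs : ∀ k, s k ∈ (C k).domain)
    (u : ι → ℝ) : DifferentiableAt ℂ (chartDensity C · u) s := by
  classical
  have hk (k : ι) : DifferentiableAt ℂ (fun z : ι → ℂ => (C k).density (z k) (u k)) s :=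
    DifferentiableAt.comp (g := ((C k).density · (u k))) s
      ((C k).differentiableAt_density (s k) (hs k) (u k)) (differentiableAt_apply k s)
  exact (HasFDerivAt.finsetProd fun k _ => (hk k).hasFDerivAt).differentiableAt

theorem differentiableAt_chartIntegral (C : ι → MellinChart η) (hf : PolytubeDecay η f)
    (hs : ∀ k, s k ∈ (C k).domain) : DifferentiableAt ℂ (chartIntegral C f) s := by
  obtain ⟨Γ, A, hΓ, hA⟩ := hf.exists_bound
  choose B hB hbound using fun k => (C k).exists_bound (s k) (hs k) (Γ k) (hΓ k)
  have hnhds : ∀ᶠ z in 𝓝 s, ∀ k, z k ∈ (C k).domain ∧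
      ∀ u, Real.exp (-((C k).point u * Γ k).re) * ‖(C k).density (z k) u‖ ≤ B k u :=
    eventually_all.2 fun k => (continuous_apply k).continuousAt.eventually
      (((C k).isOpen_domain.eventually_mem (hs k)).and (hbound k))
  refine differentiableAt_integral_of_dominated hnhds
    (fun z _ => (hf.measurable_comp_mul_chartDensity C z).aestronglyMeasurable)
    (ae_of_all _ fun u z hz =>
      (differentiableAt_chartDensity C (fun k => (hz k).1) u).const_mul _)
    ((Integrable.fintype_prod hB).const_mul |A|) (ae_of_all _ fun u z hz => ?_)
  calc ‖f (chartPoints C u) * chartDensity C z u‖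
      ≤ |A| * (∏ k, Real.exp (-(chartPoints C u k * Γ k).re)) *
          ∏ k, ‖(C k).density (z k) (u k)‖ := by
        rw [norm_mul, chartDensity, norm_prod]
        gcongr
        exact (hA _ (chartPoints_mem_polytube C u)).trans (by gcongr; exact le_abs_self A)
    _ = |A| * ∏ k, Real.exp (-((C k).point (u k) * Γ k).re) * ‖(C k).density (z k) (u k)‖ := by
        simp only [mul_assoc, Finset.prod_mul_distrib, chartPoints]
    _ ≤ |A| * ∏ k, B k (u k) := by
        gcongr with k
        exact (hz k).2 (u k)

section Update

variable [DecidableEq ι]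

theorem PolytubeDecay.slice (hf : PolytubeDecay η f) {t : ι → ℂ} (ht : t ∈ polytube ι η)
    (k : ι) : TubeDecay η fun ζ => f (Function.update t k ζ) := by
  have hmem {ζ : ℂ} (hζ : ζ ∈ tube η) : Function.update t k ζ ∈ polytube ι η := fun j => by
    rcases eq_or_ne j k with rfl | hj
    · simpa using hζ
    · simpa [hj] using ht j
  obtain ⟨Γ, A, hΓ, hA⟩ := hf.exists_bound
  refine ⟨fun ζ hζ => (hf.differentiableAt _ (hmem hζ)).comp ζ
    (hasFDerivAt_update t ζ).differentiableAt, Γ k,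
    A * ∏ j ∈ Finset.univ.erase k, Real.exp (-(t j * Γ j).re), hΓ k, fun ζ hζ => ?_⟩
  refine (hA _ (hmem hζ)).trans_eq ?_
  rw [← Finset.mul_prod_erase _ _ (Finset.mem_univ k), Function.update_self, mul_assoc,
    mul_comm (Real.exp _)]
  congr 2
  exact Finset.prod_congr rfl fun j hj => by rw [Function.update_of_ne (Finset.ne_of_mem_erase hj)]

theorem chartDensity_update (C : ι → MellinChart η) (k : ι) (D : MellinChart η) (s : ι → ℂ)
    (u : ι → ℝ) (x : ℝ) :
    chartDensity (Function.update C k D) s (Function.update u k x) =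
      D.density (s k) x * ∏ j ∈ Finset.univ.erase k, (C j).density (s j) (u j) := by
  rw [chartDensity, ← Finset.mul_prod_erase _ _ (Finset.mem_univ k), Function.update_self,
    Function.update_self]
  congr 1
  refine Finset.prod_congr rfl fun j hj => ?_
  rw [Function.update_of_ne (Finset.ne_of_mem_erase hj),
    Function.update_of_ne (Finset.ne_of_mem_erase hj)]

theorem integral_update_chartIntegrand (C : ι → MellinChart η) (k : ι) (D : MellinChart η)
    (f : (ι → ℂ) → ℂ) (s : ι → ℂ) (u : ι → ℝ) :
    ∫ x, f (chartPoints (Function.update C k D) (Function.update u k x)) *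
        chartDensity (Function.update C k D) s (Function.update u k x) =
      D.integral (fun ζ => f (Function.update (chartPoints C u) k ζ)) (s k) *
        ∏ j ∈ Finset.univ.erase k, (C j).density (s j) (u j) := by
  simp only [chartPoints_update, chartDensity_update, ← mul_assoc, MellinChart.integral,
    integral_mul_const]

theorem chartIntegral_update (C : ι → MellinChart η) (hf : PolytubeDecay η f)
    (hs : ∀ k, s k ∈ (C k).domain) {k : ι} {D : MellinChart η} (hD : s k ∈ D.domain)
    (h : ∀ g, TubeDecay η g → D.integral g (s k) = (C k).integral g (s k)) :
    chartIntegral (Function.update C k D) f s = chartIntegral C f s := by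
  have hsD : ∀ j, s j ∈ (Function.update C k D j).domain := fun j => by
    rcases eq_or_ne j k with rfl | hj
    · simpa using hD
    · simpa [hj] using hs j
  refine integral_eq_of_forall_integral_update_eq (hf.integrable_mul_chartDensity _ hsD)
    (hf.integrable_mul_chartDensity C hs) k fun u => ?_
  have hC := integral_update_chartIntegrand C k (C k) f s u
  rw [Function.update_eq_self] at hC
  rw [integral_update_chartIntegrand, hC, h _ (hf.slice (chartPoints_mem_polytube C u) k)]

end Update

theorem chartIntegral_congr (C D : ι → MellinChart η) (hf : PolytubeDecay η f)
    (hC : ∀ k, s k ∈ (C k).domain) (hD : ∀ k, s k ∈ (D k).domain)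
    (h : ∀ k g, TubeDecay η g → (D k).integral g (s k) = (C k).integral g (s k)) :
    chartIntegral D f s = chartIntegral C f s := by
  classical
  suffices ∀ S : Finset ι, chartIntegral (S.piecewise D C) f s = chartIntegral C f s by
    simpa using this Finset.univ
  intro S
  induction S using Finset.induction_on with
  | empty => simp
  | insert k S hk ih =>
    have hmem : ∀ j, s j ∈ (S.piecewise D C j).domain := fun j =>
      S.piecewise_cases D C (fun E : MellinChart η => s j ∈ E.domain) (hD j) (hC j)
    rw [Finset.piecewise_insert, chartIntegral_update _ hf hmem (hD k), ih]
    simpa [hk] using h k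

theorem exists_differentiable_eq_chartIntegral {κ : Type*} {D : κ → MellinChart η}
    (hf : PolytubeDecay η f) (hcover : ∀ z, ∃ i, z ∈ (D i).domain)
    (hcompat : ∀ i j z g, TubeDecay η g → z ∈ (D i).domain → z ∈ (D j).domain →
      (D i).integral g z = (D j).integral g z) :
    ∃ Z : (ι → ℂ) → ℂ, Differentiable ℂ Z ∧ ∀ (i : ι → κ) (s : ι → ℂ),
      (∀ k, s k ∈ (D (i k)).domain) → Z s = chartIntegral (D ∘ i) f s := by
  classical
  choose c hc using hcover
  have heq (i : ι → κ) (s : ι → ℂ) (hs : ∀ k, s k ∈ (D (i k)).domain) :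
      chartIntegral (fun k => D (c (s k))) f s = chartIntegral (D ∘ i) f s :=
    chartIntegral_congr _ _ hf hs (fun k => hc (s k))
      fun k g hg => hcompat _ _ _ g hg (hc (s k)) (hs k)
  refine ⟨fun s => chartIntegral (fun k => D (c (s k))) f s, fun s => ?_, heq⟩
  have hs : ∀ k, s k ∈ (D (c (s k))).domain := fun k => hc (s k)
  refine (differentiableAt_chartIntegral (D ∘ fun k => c (s k)) hf hs).congr_of_eventuallyEq ?_
  filter_upwards [eventually_all.2 fun k => (continuous_apply k).continuousAt.eventually
    ((D (c (s k))).isOpen_domain.mem_nhds (hs k))] with z hz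
  exact heq _ z hz

end SeveralVariables

section Hankel

variable {r : ℕ} {ε η : ℝ} {f : (Fin r → ℂ) → ℂ}

theorem integrable_prod_exp_mul_norm_hankelWeight (hε : 0 < ε) {Γ : Fin r → ℂ}
    (hΓ : ∀ k, 0 < (Γ k).re) (s : Fin r → ℂ) :
    Integrable fun u : Fin r → ℝ =>
      (∏ k, Real.exp (-(hankelPoints ε u k * Γ k).re)) * ‖hankelWeight ε s u‖ :=
  integrable_prod_exp_mul_norm_chartDensity (fun _ => hankelChart ε hε (lt_add_one ε))
    (fun _ => Set.mem_univ _) hΓ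

theorem PolytubeDecay.hankelIntegrable (hf : PolytubeDecay η f) (hε : ε ∈ Set.Ioo 0 η)
    (s : Fin r → ℂ) : HankelIntegrable ε s f :=
  hf.integrable_mul_chartDensity (fun _ => hankelChart ε hε.1 hε.2) fun _ => Set.mem_univ _

theorem chartIntegral_normalizedChart_some (hη : 0 < η) (ε : Set.Ioo 0 η)
    (f : (Fin r → ℂ) → ℂ) (s : Fin r → ℂ) :
    chartIntegral (fun _ => normalizedChart hη (some ε)) f s =
      (∏ k, hankelFactor (s k)) * hankelIntegral ε s f := by
  rw [hankelIntegral, ← integral_const_mul]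
  refine integral_congr_ae (ae_of_all _ fun u => ?_)
  simp only [chartDensity, normalizedChart, MellinChart.scale_density, Finset.prod_mul_distrib]
  exact mul_left_comm _ _ _

theorem PolytubeDecay.exists_entire_extension (hf : PolytubeDecay η f) (hη : 0 < η) :
    ∃ Z : (Fin r → ℂ) → ℂ, Differentiable ℂ Z ∧ ∀ ε ∈ Set.Ioo 0 η, ∀ s ∈ regularPoints r,
      (∏ k, hankelFactor (s k)) * hankelIntegral ε s f = Z s := by
  obtain ⟨Z, hZ, hZeq⟩ := exists_differentiable_eq_chartIntegral hf
    (exists_mem_domain_normalizedChart hη)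
    fun i j _ _ hg hi hj => integral_normalizedChart_eq hη hg hi hj
  refine ⟨Z, hZ, fun ε hε s hs => ?_⟩
  rw [hZeq (fun _ => some ⟨ε, hε⟩) s fun k =>
    (mem_domain_normalizedChart_some hη _).2 (Gamma_one_sub_ne_zero_iff.2 (hs k))]
  exact (chartIntegral_normalizedChart_some hη ⟨ε, hε⟩ f s).symm

end Hankel

section Todd

variable {z y : ℂ} {c : ℝ}

/-- The entire function `(e^z - 1)/z`. -/
noncomputable def expQuot (z : ℂ) : ℂ := dslope Complex.exp 0 z

/-- The generating function `z/(e^z - 1)` of the Bernoulli numbers. -/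
noncomputable def todd (z : ℂ) : ℂ := (expQuot z)⁻¹

theorem differentiable_expQuot : Differentiable ℂ expQuot :=
  differentiableOn_univ.1 <| (Complex.differentiableOn_dslope univ_mem).2
    Complex.differentiable_exp.differentiableOn

theorem mul_expQuot (z : ℂ) : z * expQuot z = Complex.exp z - 1 := by
  simpa [expQuot] using sub_smul_dslope Complex.exp 0 z

theorem expQuot_zero : expQuot 0 = 1 := by
  simp [expQuot, dslope_same]

theorem exp_mul_expQuot_neg (z : ℂ) : Complex.exp z * expQuot (-z) = expQuot z := by
  rcases eq_or_ne z 0 with rfl | hz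
  · simp
  · have hexp : Complex.exp z * Complex.exp (-z) = 1 := by rw [← Complex.exp_add]; simp
    apply mul_left_cancel₀ hz
    linear_combination -Complex.exp z * mul_expQuot (-z) - mul_expQuot z - hexp

theorem deriv_expQuot_zero : deriv expQuot 0 = 1 / 2 := by
  have hE : HasDerivAt expQuot (deriv expQuot 0) 0 := (differentiable_expQuot 0).hasDerivAt
  have hE_neg : HasDerivAt (fun z => expQuot (-z)) (deriv expQuot 0 * -1) 0 :=
    hE.comp_of_eq 0 (hasDerivAt_neg 0) neg_zero.symm
  have hmul := (Complex.hasDerivAt_exp 0).mul hE_neg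
  simp only [Pi.mul_def, exp_mul_expQuot_neg, neg_zero, Complex.exp_zero, expQuot_zero] at hmul
  linear_combination hE.unique hmul / 2

theorem differentiableAt_todd (hz : expQuot z ≠ 0) : DifferentiableAt ℂ todd z :=
  (differentiable_expQuot z).fun_inv hz

theorem differentiableAt_deriv_todd (hz : expQuot z ≠ 0) : DifferentiableAt ℂ (deriv todd) z :=
  ((differentiable_expQuot.analyticAt z).fun_inv hz).deriv.differentiableAt

theorem deriv_todd_zero : deriv todd 0 = -1 / 2 := by
  have h := (differentiable_expQuot 0).hasDerivAt.fun_inv (by simp [expQuot_zero])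
  rw [deriv_expQuot_zero, expQuot_zero] at h
  exact h.deriv.trans (by norm_num)

theorem neg_kernel_div_eq_dslope (hc : c ≠ 1) (hc₀ : c ≠ 0) (hy : expQuot y ≠ 0)
    (hcy : expQuot (c * y) ≠ 0) :
    (-1) / ((c : ℂ) - 1) * kernel c y = dslope todd y (c * y) := by
  have hc' : (c : ℂ) - 1 ≠ 0 := sub_ne_zero.2 (by exact_mod_cast hc)
  have hc₀' : (c : ℂ) ≠ 0 := by exact_mod_cast hc₀
  rcases eq_or_ne y 0 with rfl | hy₀
  · rw [mul_zero, dslope_same, deriv_todd_zero, kernel, if_pos rfl]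
    field_simp
  · have hsub : (c : ℂ) * y - y = (c - 1) * y := by ring
    have hne : (c : ℂ) * y ≠ y := sub_ne_zero.1 (hsub ▸ mul_ne_zero hc' hy₀)
    rw [dslope_of_ne _ hne, slope_def_field, hsub, kernel, if_neg hy₀, ← mul_expQuot,
      ← mul_expQuot, todd, todd]
    field_simp
    ring

theorem tendsto_neg_kernel_div (hy : expQuot y ≠ 0) :
    Tendsto (fun c : ℝ => (-1) / ((c : ℂ) - 1) * kernel c y) (𝓝[≠] 1) (𝓝 (deriv todd y)) := by
  have hmul : Tendsto (fun c : ℝ => (c : ℂ) * y) (𝓝[≠] 1) (𝓝 y) := by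
    have hcont : Continuous fun c : ℝ => (c : ℂ) * y := by fun_prop
    simpa using (hcont.tendsto 1).mono_left nhdsWithin_le_nhds
  have hdslope : Tendsto (dslope todd y) (𝓝 y) (𝓝 (deriv todd y)) :=
    dslope_same todd y ▸ (continuousAt_dslope_same.2 (differentiableAt_todd hy)).tendsto
  refine (hdslope.comp hmul).congr' ?_
  filter_upwards [self_mem_nhdsWithin, (eventually_ne_nhds one_ne_zero).filter_mono
    nhdsWithin_le_nhds, hmul.eventually
      (differentiable_expQuot.continuous.continuousAt.eventually_ne hy)] with c hc hc₀ hcy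
  exact (neg_kernel_div_eq_dslope hc hc₀ hy hcy).symm

theorem measurable_kernel (c : ℝ) : Measurable (kernel c) := by
  unfold kernel
  exact Measurable.ite (measurableSet_singleton 0) measurable_const (by fun_prop)

end Todd

section Wedge

variable {M a b : ℝ} {z w : ℂ}

/-- A neighbourhood of a convex sector around the positive real axis, on which the poles `2πin` of
`todd` are avoided as soon as `a < 2π`. -/
def wedge (M a : ℝ) : Set ℂ := {z | |z.im| ≤ M * z.re + a}

theorem mem_wedge_iff : z ∈ wedge M a ↔ |z.im| ≤ M * z.re + a := Iff.rfl

theorem isClosed_wedge (M a : ℝ) : IsClosed (wedge M a) :=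
  isClosed_le (by fun_prop) (by fun_prop)

theorem neg_div_le_re_of_mem_wedge (hM : 0 < M) (hz : z ∈ wedge M a) : -a / M ≤ z.re := by
  rw [div_le_iff₀' hM]
  linarith [(abs_nonneg _).trans (mem_wedge_iff.1 hz)]

theorem re_sub_re_le_of_norm_sub_le (h : ‖w - z‖ ≤ b) : z.re - w.re ≤ b :=
  (neg_sub w.re z.re).symm.trans_le
    ((neg_le_abs _).trans ((Complex.abs_re_le_norm (w - z)).trans h))

theorem mem_wedge_of_norm_sub_le (hM : 0 ≤ M) (hz : z ∈ wedge M a) (h : ‖w - z‖ ≤ b) :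
    w ∈ wedge M (a + (M + 1) * b) := by
  rw [mem_wedge_iff] at hz ⊢
  have him : |w.im| - |z.im| ≤ b :=
    (abs_sub_abs_le_abs_sub _ _).trans ((Complex.abs_im_le_norm (w - z)).trans h)
  have hre := re_sub_re_le_of_norm_sub_le h
  linarith [mul_le_mul_of_nonneg_left hre hM]

theorem ofReal_mul_mem_wedge {x : ℝ} (hx : 0 ≤ x) (hz : z ∈ wedge M a) (hb : x * a ≤ b) :
    (x : ℂ) * z ∈ wedge M b := by
  rw [mem_wedge_iff] at hz ⊢
  rw [Complex.im_ofReal_mul, Complex.re_ofReal_mul, abs_mul, abs_of_nonneg hx]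
  linarith [mul_le_mul_of_nonneg_left hz hx]

theorem expQuot_ne_zero_of_mem_wedge (ha : a < 2 * Real.pi) (hz : z ∈ wedge M a) :
    expQuot z ≠ 0 := by
  intro h
  have hexp : Complex.exp z = 1 := by
    rw [← sub_eq_zero, ← mul_expQuot, h, mul_zero]
  obtain ⟨n, rfl⟩ := Complex.exp_eq_one_iff.1 hexp
  have hn : |(n : ℝ)| * (2 * Real.pi) < 1 * (2 * Real.pi) := by
    have him : |(n : ℝ)| * (2 * Real.pi) ≤ a := by
      simpa [mem_wedge_iff, abs_mul, abs_of_pos Real.pi_pos] using hz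
    linarith
  have hn₀ : n = 0 := Int.abs_lt_one_iff.1
    (by exact_mod_cast lt_of_mul_lt_mul_right hn Real.two_pi_pos.le)
  simp [hn₀, expQuot_zero] at h

theorem differentiableAt_todd_of_mem_wedge (ha : a < 2 * Real.pi) (hz : z ∈ wedge M a) :
    DifferentiableAt ℂ todd z :=
  differentiableAt_todd (expQuot_ne_zero_of_mem_wedge ha hz)

theorem norm_todd_le_of_one_le_re (hz : 1 ≤ z.re) :
    ‖todd z‖ ≤ 2 * ‖z‖ * Real.exp (-z.re) := by
  have hexp : Real.exp z.re / 2 ≤ ‖Complex.exp z - 1‖ := by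
    have h := norm_sub_norm_le (Complex.exp z) 1
    rw [Complex.norm_exp, norm_one] at h
    linarith [Real.add_one_le_exp z.re]
  have hexp_pos := (half_pos (Real.exp_pos z.re)).trans_le hexp
  have hz₀ : z ≠ 0 := by rintro rfl; norm_num at hz
  have htodd : todd z = z / (Complex.exp z - 1) := by
    rw [todd, ← mul_expQuot, div_mul_cancel_left₀ hz₀]
  rw [htodd, norm_div, Real.exp_neg, div_le_iff₀ hexp_pos]
  calc ‖z‖ = 2 * ‖z‖ * (Real.exp z.re)⁻¹ * (Real.exp z.re / 2) := by field_simp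
    _ ≤ 2 * ‖z‖ * (Real.exp z.re)⁻¹ * ‖Complex.exp z - 1‖ := by gcongr

theorem exists_norm_todd_le (hM : 0 < M) (ha : a < 2 * Real.pi) {κ : ℝ} (hκ : κ < 1) :
    ∃ A : ℝ, ∀ z ∈ wedge M a, ‖todd z‖ ≤ A * Real.exp (-(κ * z.re)) := by
  have hcompact : IsCompact (wedge M a ∩ Set.Icc (-a / M) 1 ×ℂ Set.Icc (-(M + a)) (M + a)) :=
    (isCompact_Icc.reProdIm isCompact_Icc).inter_left (isClosed_wedge M a)
  have hcont : ContinuousOn (fun z => todd z * Complex.exp (κ * z))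
      (wedge M a ∩ Set.Icc (-a / M) 1 ×ℂ Set.Icc (-(M + a)) (M + a)) := fun z hz =>
    ((differentiableAt_todd_of_mem_wedge ha hz.1).continuousAt.mul
      (by fun_prop)).continuousWithinAt
  obtain ⟨B, hB⟩ := hcompact.exists_bound_of_continuousOn hcont
  refine ⟨max B (2 * (M + |a| + 1) / (1 - κ)), fun z hz => ?_⟩
  have hz' := mem_wedge_iff.1 hz
  rcases le_total 1 z.re with hre | hre
  · have hnorm : ‖z‖ ≤ (M + |a| + 1) * z.re := by
      have := Complex.norm_le_abs_re_add_abs_im z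
      rw [abs_of_pos (one_pos.trans_le hre)] at this
      linarith [le_abs_self a, mul_le_mul_of_nonneg_left hre (abs_nonneg a)]
    have hlin : z.re ≤ Real.exp ((1 - κ) * z.re) / (1 - κ) := by
      rw [le_div_iff₀' (sub_pos.2 hκ)]
      linarith [Real.add_one_le_exp ((1 - κ) * z.re)]
    calc ‖todd z‖ ≤ 2 * ‖z‖ * Real.exp (-z.re) := norm_todd_le_of_one_le_re hre
      _ ≤ 2 * ((M + |a| + 1) * (Real.exp ((1 - κ) * z.re) / (1 - κ))) * Real.exp (-z.re) := by
          gcongr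
          exact hnorm.trans (by gcongr)
      _ = 2 * (M + |a| + 1) / (1 - κ) * Real.exp (-(κ * z.re)) := by
          rw [show -(κ * z.re) = (1 - κ) * z.re + -z.re by ring, Real.exp_add]
          ring
      _ ≤ _ := by gcongr; exact le_max_right _ _
  · have him := abs_le.1 (hz'.trans
      (add_le_add_left (mul_le_of_le_one_right hM.le hre) a))
    have hbound := hB z ⟨hz, ⟨neg_div_le_re_of_mem_wedge hM hz, hre⟩, him⟩
    rw [norm_mul, Complex.norm_exp, Complex.re_ofReal_mul, ← le_div_iff₀ (Real.exp_pos _)] at hbound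
    rw [Real.exp_neg, ← div_eq_mul_inv]
    exact hbound.trans (by gcongr; exact le_max_left _ _)

theorem exists_norm_deriv_todd_le (hM : 0 < M) (ha : a < 2 * Real.pi) {κ : ℝ} (hκ₀ : 0 ≤ κ)
    (hκ : κ < 1) : ∃ A : ℝ, ∀ z ∈ wedge M a, ‖deriv todd z‖ ≤ A * Real.exp (-(κ * z.re)) := by
  obtain ⟨ρ, hρ, hρ_lt⟩ : ∃ ρ : ℝ, 0 < ρ ∧ a + (M + 1) * ρ < 2 * Real.pi := by
    refine ⟨(2 * Real.pi - a) / (2 * (M + 1)), div_pos (by linarith) (by linarith), ?_⟩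
    field_simp
    linarith
  obtain ⟨A, hA⟩ := exists_norm_todd_le hM hρ_lt hκ
  refine ⟨|A| * Real.exp (κ * ρ) / ρ, fun z hz => ?_⟩
  have hmem {w : ℂ} (hw : ‖w - z‖ ≤ ρ) : w ∈ wedge M (a + (M + 1) * ρ) :=
    mem_wedge_of_norm_sub_le hM.le hz hw
  have hdiff : DifferentiableOn ℂ todd (Metric.closedBall z ρ) := fun w hw =>
    (differentiableAt_todd_of_mem_wedge hρ_lt
      (hmem (mem_closedBall_iff_norm.1 hw))).differentiableWithinAt
  have hsphere (w : ℂ) (hw : w ∈ Metric.sphere z ρ) :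
      ‖todd w‖ ≤ |A| * Real.exp (κ * ρ) * Real.exp (-(κ * z.re)) := by
    have hw' : ‖w - z‖ ≤ ρ := (mem_sphere_iff_norm.1 hw).le
    rw [mul_assoc, ← Real.exp_add]
    refine (hA w (hmem hw')).trans ?_
    gcongr
    · exact le_abs_self A
    · linarith [mul_le_mul_of_nonneg_left (re_sub_re_le_of_norm_sub_le hw') hκ₀]
  refine (Complex.norm_deriv_le_of_forall_mem_sphere_norm_le hρ
    (hdiff.diffContOnCl_ball subset_rfl) hsphere).trans_eq ?_
  ring

theorem norm_dslope_le_of_forall_segment {f : ℂ → ℂ} {B : ℝ}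
    (hf : ∀ x ∈ segment ℝ z w, DifferentiableAt ℂ f x)
    (hB : ∀ x ∈ segment ℝ z w, ‖deriv f x‖ ≤ B) : ‖dslope f z w‖ ≤ B := by
  rcases eq_or_ne w z with rfl | hne
  · rw [dslope_same]
    exact hB w (left_mem_segment ℝ w w)
  · rw [dslope_of_ne _ hne, slope_def_field, norm_div,
      div_le_iff₀ (norm_pos_iff.2 (sub_ne_zero.2 hne))]
    exact (convex_segment z w).norm_image_sub_le_of_norm_deriv_le hf hB
      (left_mem_segment ℝ z w) (right_mem_segment ℝ z w)

theorem exists_eq_mul_of_mem_segment {c : ℝ} {x y : ℂ} (hc : |c - 1| < 1 / 3)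
    (hx : x ∈ segment ℝ y (c * y)) : ∃ σ : ℝ, |σ - 1| < 1 / 3 ∧ x = σ * y := by
  obtain ⟨θ, hθ, rfl⟩ := segment_eq_image_lineMap ℝ y (c * y) ▸ hx
  refine ⟨1 + θ * (c - 1), ?_, ?_⟩
  · rw [add_sub_cancel_left, abs_mul, abs_of_nonneg hθ.1]
    exact (mul_le_of_le_one_left (abs_nonneg _) hθ.2).trans_lt hc
  · simp only [AffineMap.lineMap_apply, vsub_eq_sub, vadd_eq_add, Complex.real_smul]
    push_cast
    ring

theorem four_thirds_lt_two_pi : (4 / 3 : ℝ) < 2 * Real.pi := by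
  linarith [Real.pi_gt_three]

theorem exists_norm_dslope_todd_le (hM : 0 < M) :
    ∃ A : ℝ, 0 < A ∧ ∀ c : ℝ, |c - 1| < 1 / 3 → ∀ y ∈ wedge M 1,
      ‖dslope todd y (c * y)‖ ≤ A * Real.exp (-(y.re / 2)) := by
  obtain ⟨A, hA⟩ := exists_norm_deriv_todd_le hM four_thirds_lt_two_pi (κ := 3 / 4)
    (by norm_num) (by norm_num)
  refine ⟨(|A| + 1) * Real.exp (1 / M), by positivity, fun c hc y hy => ?_⟩
  have hmem {σ : ℝ} (hσ : |σ - 1| < 1 / 3) : (σ : ℂ) * y ∈ wedge M (4 / 3) := by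
    have := abs_lt.1 hσ
    exact ofReal_mul_mem_wedge (by linarith) hy (by linarith)
  refine norm_dslope_le_of_forall_segment (fun x hx => ?_) fun x hx => ?_ <;>
    obtain ⟨σ, hσ, rfl⟩ := exists_eq_mul_of_mem_segment hc hx
  · exact differentiableAt_todd_of_mem_wedge four_thirds_lt_two_pi (hmem hσ)
  · have hexp : y.re / 2 ≤ 3 / 4 * (σ * y.re) + 1 / M := by
      have hre := neg_div_le_re_of_mem_wedge hM hy
      have hσ' := abs_lt.1 hσ
      rw [neg_div] at hre
      rcases le_total 0 y.re with hpos | hneg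
      · have := mul_nonneg (by linarith : 0 ≤ σ - 2 / 3) hpos
        have := one_div_pos.2 hM
        linarith
      · have := mul_nonneg (by linarith : 0 ≤ 4 / 3 - σ) (neg_nonneg.2 hneg)
        linarith
    rw [mul_assoc, ← Real.exp_add]
    refine (hA _ (hmem hσ)).trans ?_
    rw [Complex.re_ofReal_mul]
    gcongr
    · linarith [le_abs_self A]
    · linarith

end Wedge

section Desingularization

variable {r : ℕ} {γ t : Fin r → ℂ} {ε η : ℝ}

theorem prod_exp_tailArg (γ t : Fin r → ℂ) :
    ∏ j, Real.exp (-((tailArg γ t j).re / 2)) = majorant γ t := by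
  have hsum : ∑ j, tailArg γ t j = ∑ k, t k * ∑ j ∈ Finset.Iic k, γ j := by
    simp only [tailArg, Finset.mul_sum]
    rw [Finset.sum_comm' (t' := Finset.univ) (s' := Finset.Iic) (by simp)]
    simp only [mul_comm]
  rw [majorant, ← Real.exp_sum, ← Real.exp_sum, Finset.sum_neg_distrib, Finset.sum_neg_distrib]
  simp only [mul_div_assoc', Complex.div_ofNat_re]
  rw [← Finset.sum_div, ← Finset.sum_div, ← Complex.re_sum, ← Complex.re_sum, hsum]

theorem re_half_sum_Iic_pos (hγ : ∀ j, 0 < (γ j).re) (k : Fin r) :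
    0 < ((∑ j ∈ Finset.Iic k, γ j) / 2).re := by
  rw [Complex.div_ofNat_re, Complex.re_sum]
  exact half_pos (Finset.sum_pos (fun j _ => hγ j) ⟨k, by simp⟩)

theorem integrable_majorant_mul_norm_hankelWeight (hγ : ∀ j, 0 < (γ j).re) (hε : 0 < ε)
    (s : Fin r → ℂ) :
    Integrable fun u => majorant γ (hankelPoints ε u) * ‖hankelWeight ε s u‖ :=
  integrable_prod_exp_mul_norm_hankelWeight hε (re_half_sum_Iic_pos hγ) s

theorem hankelPoints_mem_polytube (hε : ε ∈ Set.Ioo 0 η) (u : Fin r → ℝ) :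
    hankelPoints ε u ∈ polytube (Fin r) η :=
  fun k => hankelPoint_mem_tube hε.1 hε.2 (u k)

theorem continuous_tailArg (γ : Fin r → ℂ) (j : Fin r) : Continuous fun t => tailArg γ t j := by
  unfold tailArg
  fun_prop

theorem measurable_tildeH (γ : Fin r → ℂ) (c : ℝ) : Measurable (tildeH γ c) :=
  Finset.measurable_prod _ fun j _ =>
    (measurable_kernel c).comp (continuous_tailArg γ j).measurable

theorem measurable_hankelWeight (hε : 0 < ε) (s : Fin r → ℂ) :
    Measurable (hankelWeight ε s) :=
  measurable_chartDensity (fun _ => hankelChart ε hε (lt_add_one ε)) s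

theorem prod_neg_kernel_div (γ t : Fin r → ℂ) (c : ℝ) :
    ∏ j, ((-1) / ((c : ℂ) - 1) * kernel c (tailArg γ t j)) =
      (-1) ^ r / ((c : ℂ) - 1) ^ r * tildeH γ c t := by
  rw [Finset.prod_mul_distrib, tildeH, Finset.prod_const, Finset.card_univ, Fintype.card_fin,
    div_pow]

/-- A radius `η` for which every argument `tailArg γ t j` stays in a wedge free of poles of `todd`
while `t` ranges over the polytube of radius `η`. -/
structure IsAdmissibleRadius (γ : Fin r → ℂ) (η : ℝ) : Prop where
  pos : 0 < η
  exists_wedge : ∀ j, ∃ M : ℝ, 0 < M ∧ ∀ t ∈ polytube (Fin r) η, tailArg γ t j ∈ wedge M 1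

theorem mul_ofReal_mem_wedge {z : ℂ} (hz : 0 < z.re) {x : ℝ} (hx : 0 ≤ x) :
    z * x ∈ wedge (‖z‖ / z.re) 0 := by
  rw [mem_wedge_iff, Complex.im_mul_ofReal, Complex.re_mul_ofReal, abs_mul, abs_of_nonneg hx,
    add_zero, ← mul_assoc, div_mul_cancel₀ _ hz.ne']
  gcongr
  exact Complex.abs_im_le_norm z

theorem exists_norm_tailArg_sub_le (γ : Fin r → ℂ) (hη : 0 ≤ η) (ht : t ∈ polytube (Fin r) η)
    (j : Fin r) : ∃ x : ℝ, 0 ≤ x ∧ ‖tailArg γ t j - γ j * x‖ ≤ ‖γ j‖ * (r * η) := by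
  choose x hx hxt using fun k => mem_tube_iff.1 (ht k)
  refine ⟨∑ k ∈ Finset.Ici j, x k, Finset.sum_nonneg fun k _ => hx k, ?_⟩
  rw [tailArg, Complex.ofReal_sum, ← mul_sub, ← Finset.sum_sub_distrib, norm_mul]
  gcongr
  calc ‖∑ k ∈ Finset.Ici j, (t k - x k)‖ ≤ ∑ _k ∈ Finset.Ici j, η :=
        norm_sum_le_of_le _ fun k _ => (hxt k).le
    _ ≤ ∑ _k : Fin r, η := Finset.sum_le_univ_sum_of_nonneg fun _ => hη
    _ = r * η := by simp

theorem exists_isAdmissibleRadius (hγ : ∀ j, 0 < (γ j).re) : ∃ η, IsAdmissibleRadius γ η := by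
  have hsmall : ∀ᶠ η : ℝ in 𝓝[>] 0, ∀ j, (‖γ j‖ / (γ j).re + 1) * (‖γ j‖ * (r * η)) < 1 := by
    refine eventually_all.2 fun j => ?_
    have hcont : Continuous fun η : ℝ => (‖γ j‖ / (γ j).re + 1) * (‖γ j‖ * (r * η)) := by fun_prop
    exact ((hcont.tendsto 0).mono_left nhdsWithin_le_nhds).eventually_lt_const (by simp)
  obtain ⟨η, hη, hη₀ : 0 < η⟩ := (hsmall.and self_mem_nhdsWithin).exists
  refine ⟨η, hη₀, fun j => ⟨‖γ j‖ / (γ j).re, ?_, fun t ht => ?_⟩⟩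
  · exact div_pos (norm_pos_iff.2 fun h => (hγ j).ne' (by simp [h])) (hγ j)
  · obtain ⟨x, hx, hxt⟩ := exists_norm_tailArg_sub_le γ hη₀.le ht j
    have hmem := mem_wedge_of_norm_sub_le (div_nonneg (norm_nonneg _) (hγ j).le)
      (mul_ofReal_mem_wedge (hγ j) hx) hxt
    rw [mem_wedge_iff] at hmem ⊢
    linarith [hη j]

theorem eventually_abs_sub_one_lt : ∀ᶠ c : ℝ in 𝓝[≠] 1, c ≠ 1 ∧ |c - 1| < 1 / 3 :=
  eventually_mem_nhdsWithin.and <| eventually_nhdsWithin_of_eventually_nhds <|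
    Metric.ball_mem_nhds (1 : ℝ) (by norm_num)

/-- The limit of `(-1)^r (c - 1)^{-r} H̃_r(t; γ; c)` as `c → 1`. -/
noncomputable def limitH (γ t : Fin r → ℂ) : ℂ := ∏ j, deriv todd (tailArg γ t j)

namespace IsAdmissibleRadius

theorem expQuot_tailArg_ne_zero (h : IsAdmissibleRadius γ η) (ht : t ∈ polytube (Fin r) η)
    (j : Fin r) : expQuot (tailArg γ t j) ≠ 0 := by
  obtain ⟨M, -, hM⟩ := h.exists_wedge j
  exact expQuot_ne_zero_of_mem_wedge (by linarith [Real.pi_gt_three]) (hM t ht)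

theorem tendsto_neg_kernel_div_tailArg (h : IsAdmissibleRadius γ η)
    (ht : t ∈ polytube (Fin r) η) (j : Fin r) :
    Tendsto (fun c : ℝ => (-1) / ((c : ℂ) - 1) * kernel c (tailArg γ t j)) (𝓝[≠] 1)
      (𝓝 (deriv todd (tailArg γ t j))) :=
  tendsto_neg_kernel_div (h.expQuot_tailArg_ne_zero ht j)

theorem tendsto_tildeH (h : IsAdmissibleRadius γ η) (ht : t ∈ polytube (Fin r) η) :
    Tendsto (fun c : ℝ => (-1) ^ r / ((c : ℂ) - 1) ^ r * tildeH γ c t) (𝓝[≠] 1)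
      (𝓝 (limitH γ t)) := by
  simp only [← prod_neg_kernel_div]
  exact tendsto_finsetProd _ fun j _ => h.tendsto_neg_kernel_div_tailArg ht j

theorem prod_limUnder_kernel (h : IsAdmissibleRadius γ η) (ht : t ∈ polytube (Fin r) η) :
    ∏ j, limUnder (𝓝[≠] (1 : ℝ))
      (fun c : ℝ => (-1) / ((c : ℂ) - 1) * kernel c (tailArg γ t j)) = limitH γ t :=
  Finset.prod_congr rfl fun j _ => (h.tendsto_neg_kernel_div_tailArg ht j).limUnder_eq

theorem exists_norm_kernel_tailArg_le (h : IsAdmissibleRadius γ η) (j : Fin r) :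
    ∃ A : ℝ, 0 < A ∧ ∀ c : ℝ, c ≠ 1 → |c - 1| < 1 / 3 → ∀ t ∈ polytube (Fin r) η,
      ‖(-1) / ((c : ℂ) - 1) * kernel c (tailArg γ t j)‖ ≤
        A * Real.exp (-((tailArg γ t j).re / 2)) := by
  obtain ⟨M, hM, hwedge⟩ := h.exists_wedge j
  obtain ⟨A, hA, hbound⟩ := exists_norm_dslope_todd_le hM
  refine ⟨A, hA, fun c hc hc' t ht => ?_⟩
  have hc_bounds := abs_lt.1 hc'
  have hmem : (c : ℂ) * tailArg γ t j ∈ wedge M (4 / 3) :=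
    ofReal_mul_mem_wedge (by linarith) (hwedge t ht) (by linarith)
  rw [neg_kernel_div_eq_dslope hc (by linarith) (h.expQuot_tailArg_ne_zero ht j)
    (expQuot_ne_zero_of_mem_wedge four_thirds_lt_two_pi hmem)]
  exact hbound c hc' _ (hwedge t ht)

theorem exists_norm_tildeH_le (h : IsAdmissibleRadius γ η) :
    ∃ A : ℝ, 0 < A ∧ ∀ c : ℝ, c ≠ 1 → |c - 1| < 1 / 3 → ∀ t ∈ polytube (Fin r) η,
      ‖(-1) ^ r / ((c : ℂ) - 1) ^ r * tildeH γ c t‖ ≤ A * majorant γ t := by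
  choose A hA hbound using h.exists_norm_kernel_tailArg_le
  refine ⟨∏ j, A j, Finset.prod_pos fun j _ => hA j, fun c hc hc' t ht => ?_⟩
  rw [← prod_neg_kernel_div, ← prod_exp_tailArg, ← Finset.prod_mul_distrib, norm_prod]
  exact Finset.prod_le_prod (fun _ _ => norm_nonneg _) fun j _ => hbound j c hc hc' t ht

theorem differentiableAt_limitH (h : IsAdmissibleRadius γ η) (ht : t ∈ polytube (Fin r) η) :
    DifferentiableAt ℂ (limitH γ) t := by
  have hfactor (j : Fin r) : DifferentiableAt ℂ (fun t => deriv todd (tailArg γ t j)) t := by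
    have htail : DifferentiableAt ℂ (fun t => tailArg γ t j) t := by
      unfold tailArg
      fun_prop
    exact (differentiableAt_deriv_todd (h.expQuot_tailArg_ne_zero ht j)).comp t htail
  exact (HasFDerivAt.finsetProd fun j _ => (hfactor j).hasFDerivAt).differentiableAt

theorem polytubeDecay_limitH (h : IsAdmissibleRadius γ η) (hγ : ∀ j, 0 < (γ j).re) :
    PolytubeDecay η (limitH γ) := by
  obtain ⟨A, -, hA⟩ := h.exists_norm_tildeH_le
  refine ⟨fun t ht => h.differentiableAt_limitH ht, _, A, re_half_sum_Iic_pos hγ, fun t ht => ?_⟩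
  refine le_of_tendsto (h.tendsto_tildeH ht).norm ?_
  filter_upwards [eventually_abs_sub_one_lt] with c hc
  exact hA c hc.1 hc.2 t ht

theorem exists_norm_tildeH_mul_hankelWeight_le (h : IsAdmissibleRadius γ η)
    (hε : ε ∈ Set.Ioo 0 η) (s : Fin r → ℂ) :
    ∃ A : ℝ, ∀ c : ℝ, c ≠ 1 → |c - 1| < 1 / 3 → ∀ u,
      ‖(-1) ^ r / ((c : ℂ) - 1) ^ r * (tildeH γ c (hankelPoints ε u) * hankelWeight ε s u)‖ ≤
        A * (majorant γ (hankelPoints ε u) * ‖hankelWeight ε s u‖) := by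
  obtain ⟨A, -, hA⟩ := h.exists_norm_tildeH_le
  refine ⟨A, fun c hc hc' u => ?_⟩
  rw [← mul_assoc, norm_mul, ← mul_assoc]
  exact mul_le_mul_of_nonneg_right (hA c hc hc' _ (hankelPoints_mem_polytube hε u))
    (norm_nonneg _)

theorem hankelIntegrable_tildeH (h : IsAdmissibleRadius γ η) (hγ : ∀ j, 0 < (γ j).re)
    (hε : ε ∈ Set.Ioo 0 η) {c : ℝ} (hc : c ≠ 1) (hc' : |c - 1| < 1 / 3) (s : Fin r → ℂ) :
    HankelIntegrable ε s (tildeH γ c) := by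
  obtain ⟨A, hA⟩ := h.exists_norm_tildeH_mul_hankelWeight_le hε s
  have hne : (-1) ^ r / ((c : ℂ) - 1) ^ r ≠ 0 :=
    div_ne_zero (pow_ne_zero _ (by norm_num)) (pow_ne_zero _ (sub_ne_zero.2 (by exact_mod_cast hc)))
  have hmeas : Measurable fun u => tildeH γ c (hankelPoints ε u) * hankelWeight ε s u :=
    ((measurable_tildeH γ c).comp
      (continuous_chartPoints fun _ => hankelChart ε hε.1 hε.2).measurable).mul
      (measurable_hankelWeight hε.1 s)
  rw [HankelIntegrable, ← integrable_const_mul_iff hne.isUnit]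
  exact ((integrable_majorant_mul_norm_hankelWeight hγ hε.1 s).const_mul A).mono'
    (hmeas.const_mul _).aestronglyMeasurable (ae_of_all _ (hA c hc hc'))

theorem tendsto_hankelIntegral_tildeH (h : IsAdmissibleRadius γ η) (hγ : ∀ j, 0 < (γ j).re)
    (hε : ε ∈ Set.Ioo 0 η) (s : Fin r → ℂ) :
    Tendsto (fun c : ℝ => (-1) ^ r / ((c : ℂ) - 1) ^ r * hankelIntegral ε s (tildeH γ c))
      (𝓝[≠] 1) (𝓝 (hankelIntegral ε s (limitH γ))) := by
  obtain ⟨A, hA⟩ := h.exists_norm_tildeH_mul_hankelWeight_le hε s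
  simp only [hankelIntegral, ← integral_const_mul]
  refine tendsto_integral_filter_of_dominated_convergence _ ?_ ?_
    ((integrable_majorant_mul_norm_hankelWeight hγ hε.1 s).const_mul A) (ae_of_all _ fun u => ?_)
  · filter_upwards [eventually_abs_sub_one_lt] with c hc
    exact (h.hankelIntegrable_tildeH hγ hε hc.1 hc.2 s).aestronglyMeasurable.const_mul _
  · filter_upwards [eventually_abs_sub_one_lt] with c hc
    exact ae_of_all _ (hA c hc.1 hc.2)
  · simp only [← mul_assoc]
    exact (h.tendsto_tildeH (hankelPoints_mem_polytube hε u)).mul_const _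

theorem tendsto_preDesZeta (h : IsAdmissibleRadius γ η) (hγ : ∀ j, 0 < (γ j).re)
    (hε : ε ∈ Set.Ioo 0 η) (s : Fin r → ℂ) :
    Tendsto (fun c => preDesZeta ε γ c s) (𝓝[≠] 1)
      (𝓝 ((∏ k, hankelFactor (s k)) * hankelIntegral ε s (limitH γ))) := by
  refine ((h.tendsto_hankelIntegral_tildeH hγ hε s).const_mul _).congr fun c => ?_
  rw [preDesZeta]
  ring

theorem desZeta_eq (h : IsAdmissibleRadius γ η) (hγ : ∀ j, 0 < (γ j).re)
    (hε : ε ∈ Set.Ioo 0 η) (s : Fin r → ℂ) :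
    desZeta ε γ s = (∏ k, hankelFactor (s k)) * hankelIntegral ε s (limitH γ) :=
  (h.tendsto_preDesZeta hγ hε s).limUnder_eq

theorem exists_domination (h : IsAdmissibleRadius γ η) (hγ : ∀ j, 0 < (γ j).re)
    (hε : ε ∈ Set.Ioo 0 η) :
    ∃ A : ℝ, 0 < A ∧
      (∀ c : ℝ, c ≠ 1 → |c - 1| < 1 / 3 → ∀ u : Fin r → ℝ,
        ‖(((c : ℂ) - 1) ^ r)⁻¹ * tildeH γ c (hankelPoints ε u)‖ ≤
          A * majorant γ (hankelPoints ε u)) ∧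
      ∀ s : Fin r → ℂ,
        Integrable fun u => A * majorant γ (hankelPoints ε u) * ‖hankelWeight ε s u‖ := by
  obtain ⟨A, hA₀, hA⟩ := h.exists_norm_tildeH_le
  refine ⟨A, hA₀, fun c hc hc' u => ?_, fun s => ?_⟩
  · simpa [div_eq_mul_inv] using hA c hc hc' _ (hankelPoints_mem_polytube hε u)
  · simpa only [mul_assoc] using
      (integrable_majorant_mul_norm_hankelWeight hγ hε.1 s).const_mul A

end IsAdmissibleRadius

end Desingularization

end DesZeta

theorem theorem2 (r : ℕ) (γ : Fin r → ℂ) (hγ : ∀ j, 0 < (γ j).re) :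
    ∃ ε₀ : ℝ, 0 < ε₀ ∧
      -- for every Hankel contour whose circle is small enough:
      (∀ ε : ℝ, 0 < ε → ε < ε₀ →
        -- domination by an exponential majorant independent of `c`,
        (∃ δ : ℝ, 0 < δ ∧ ∃ A : ℝ, 0 < A ∧
          (∀ c : ℝ, c ≠ 1 → |c - 1| < δ → ∀ u : Fin r → ℝ,
            ‖(((c : ℂ) - 1) ^ r)⁻¹ * DesZeta.tildeH γ c (DesZeta.hankelPoints ε u)‖
              ≤ A * DesZeta.majorant γ (DesZeta.hankelPoints ε u)) ∧
          (∀ s : Fin r → ℂ, MeasureTheory.Integrable (fun u : Fin r → ℝ =>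
            A * DesZeta.majorant γ (DesZeta.hankelPoints ε u) * ‖DesZeta.hankelWeight ε s u‖)) ∧
          -- absolute convergence of the contour integrals for `c` near `1`,
          (∀ c : ℝ, c ≠ 1 → |c - 1| < δ → ∀ s : Fin r → ℂ,
            DesZeta.HankelIntegrable ε s (DesZeta.tildeH γ c))) ∧
        -- existence of the limits under the integral signs,
        (∀ u : Fin r → ℝ,
          (∃ l : ℂ, Filter.Tendsto (fun c : ℝ => (-1) ^ r / ((c : ℂ) - 1) ^ r *
              DesZeta.tildeH γ c (DesZeta.hankelPoints ε u))
            (nhdsWithin 1 {1}ᶜ) (nhds l)) ∧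
          ∀ j : Fin r, ∃ l : ℂ, Filter.Tendsto (fun c : ℝ => (-1) / ((c : ℂ) - 1) *
              DesZeta.kernel c (DesZeta.tailArg γ (DesZeta.hankelPoints ε u) j))
            (nhdsWithin 1 {1}ᶜ) (nhds l)) ∧
        -- absolute convergence of the integrals of the limits,
        (∀ s : Fin r → ℂ,
          DesZeta.HankelIntegrable ε s (fun t => limUnder (nhdsWithin (1 : ℝ) {1}ᶜ)
            (fun c : ℝ => (-1) ^ r / ((c : ℂ) - 1) ^ r * DesZeta.tildeH γ c t)) ∧
          DesZeta.HankelIntegrable ε s (fun t => ∏ j, limUnder (nhdsWithin (1 : ℝ) {1}ᶜ)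
            (fun c : ℝ => (-1) / ((c : ℂ) - 1) * DesZeta.kernel c (DesZeta.tailArg γ t j)))) ∧
        -- existence of the limit that defines the function, and the two formulas for it
        (∀ s ∈ DesZeta.regularPoints r,
          Filter.Tendsto (fun c : ℝ => DesZeta.preDesZeta ε γ c s)
            (nhdsWithin 1 {1}ᶜ) (nhds (DesZeta.desZeta ε γ s)) ∧
          DesZeta.desZeta ε γ s = (∏ k, DesZeta.hankelFactor (s k)) *
            DesZeta.hankelIntegral ε s (fun t => limUnder (nhdsWithin (1 : ℝ) {1}ᶜ)
              (fun c : ℝ => (-1) ^ r / ((c : ℂ) - 1) ^ r * DesZeta.tildeH γ c t)) ∧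
          DesZeta.desZeta ε γ s = (∏ k, DesZeta.hankelFactor (s k)) *
            DesZeta.hankelIntegral ε s (fun t => ∏ j, limUnder (nhdsWithin (1 : ℝ) {1}ᶜ)
              (fun c : ℝ =>
                (-1) / ((c : ℂ) - 1) * DesZeta.kernel c (DesZeta.tailArg γ t j))))) ∧
      -- and the function extends to an entire function, the same for all small `ε`
      ∃ Z : (Fin r → ℂ) → ℂ, Differentiable ℂ Z ∧
        ∀ ε : ℝ, 0 < ε → ε < ε₀ → ∀ s ∈ DesZeta.regularPoints r,
          Z s = DesZeta.desZeta ε γ s := by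
  obtain ⟨η, hη⟩ := DesZeta.exists_isAdmissibleRadius hγ
  have hdecay := hη.polytubeDecay_limitH hγ
  refine ⟨η, hη.pos, fun ε hε₀ hεη => ?_, ?_⟩
  · have hε : ε ∈ Set.Ioo 0 η := ⟨hε₀, hεη⟩
    have hmem := DesZeta.hankelPoints_mem_polytube (r := r) hε
    have hlimH u := (hη.tendsto_tildeH (hmem u)).limUnder_eq
    have hlimK u := hη.prod_limUnder_kernel (hmem u)
    obtain ⟨A, hA, hbound, hint⟩ := hη.exists_domination hγ hε
    refine ⟨⟨1 / 3, by norm_num, A, hA, hbound, hint, fun c => hη.hankelIntegrable_tildeH hγ hε⟩,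
      fun u => ⟨⟨_, hη.tendsto_tildeH (hmem u)⟩,
        fun j => ⟨_, hη.tendsto_neg_kernel_div_tailArg (hmem u) j⟩⟩, fun s => ?_, fun s _ => ?_⟩
    · simpa only [DesZeta.HankelIntegrable, hlimH, hlimK, and_self] using
        hdecay.hankelIntegrable hε s
    · simp only [DesZeta.hankelIntegral, hlimH, hlimK, hη.desZeta_eq hγ hε, and_self, and_true]
      exact hη.tendsto_preDesZeta hγ hε s
  · obtain ⟨Z, hZ, hZ_eq⟩ := hdecay.exists_entire_extension hη.pos
    exact ⟨Z, hZ, fun ε hε₀ hεη s hs =>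
      (hZ_eq ε ⟨hε₀, hεη⟩ s hs).symm.trans (hη.desZeta_eq hγ ⟨hε₀, hεη⟩ s).symm⟩
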